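/- Let $S\subset\mathbb C^2$ be a smooth simply-connected (embedded, not necessarily compact or closed) real hypersurface that is strongly $\mathbb C$-convex, i.e. every point of $S$ has a neighbourhood in $S$ that some projective transformation of $\mathbb{CP}^2$ maps onto a strongly convex real hypersurface of $\mathbb C^2$ (one with a local defining function whose real Hessian is positive definite on tangent spaces). Assume that no complex tangent line of $S$ passes through the origin. For $j=1,2$ let $$w_j=\frac{\partial\rho/\partial z_j}{z_1\,\partial\rho/\partial z_1+z_2\,\partial\rho/\partial z_2}\quad\text{on } S,$$ where $\rho$ is any local defining function of $S$ (the $w_j$ do not depend on the choice). The projective dual CR structure on $S$ is the unique CR structure on $S$ for which $w_1,w_2$ are CR functions; smooth functions that are CR for it are called dual-CR. Then there are unique smooth complex tangential vector fields $X,T$ on $S$ with $$Xz_1=Xz_2=0,\quad Xw_1=z_2,\quad Xw_2=-z_1,\qquad Tz_1=w_2,\quad Tz_2=-w_1,\quad Tw_1=Tw_2=0,$$ and for every smooth function $u\colon S\to\mathbb C$ the following conditions are equivalent: (i) $u=f+g$ on $S$ for some smooth CR function $f$ and some smooth dual-CR function $g$ on $S$; (ii) $XXTu=0=TTXu$ on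 $S$. -/

import Mathlib

open scoped ContDiff ComplexConjugate

noncomputable section

/-- The complex plane `ℂ²` with coordinates `z 0, z 1`. -/
abbrev CPlane : Type := Fin 2 → ℂ

/-- Complex tangent vectors of `ℂ²`: the pair `(a, b)` stands for
`∑ j, (a j ∂/∂z_j + b j ∂/∂z̄_j)`, so that `ℂ ⊗ ℝ⁴` is `ℂ² × ℂ²` with its usual complex vector
space structure. -/
abbrev CVec : Type := CPlane × CPlane

/-- The real vector `A` in the decomposition `V = A + i B` of a complex tangent vector. -/
def CVec.realPart (V : CVec) : CPlane := fun j => (V.1 j + conj (V.2 j)) / 2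

/-- The real vector `B` in the decomposition `V = A + i B` of a complex tangent vector. -/
def CVec.imagPart (V : CVec) : CPlane := fun j => (V.1 j - conj (V.2 j)) / (2 * Complex.I)

/-- The complex conjugate `A - i B` of the complex tangent vector `A + i B`. -/
def CVec.conjugate (V : CVec) : CVec := (fun j => conj (V.2 j), fun j => conj (V.1 j))

/-! ### Real hypersurfaces and their tangent spaces -/

/-- `ρ` is a smooth defining function of `S` in the open set `U`. -/
structure IsDefiningFunctionOn (S U : Set CPlane) (ρ : CPlane → ℝ) : Prop where
  isOpen : IsOpen U
  smooth : ContDiffOn ℝ ∞ ρ U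
  zero_iff : ∀ q ∈ U, q ∈ S ↔ ρ q = 0
  fderiv_ne_zero : ∀ q ∈ S ∩ U, fderiv ℝ ρ q ≠ 0

/-- `ρ` is a smooth defining function of `S` near `p`. -/
def IsDefiningFunctionAt (S : Set CPlane) (p : CPlane) (ρ : CPlane → ℝ) : Prop :=
  ∃ U : Set CPlane, p ∈ U ∧ IsDefiningFunctionOn S U ρ

/-- `S` is a smooth (embedded) real hypersurface in `ℂ²`. -/
def IsRealHypersurface (S : Set CPlane) : Prop :=
  ∀ p ∈ S, ∃ ρ : CPlane → ℝ, IsDefiningFunctionAt S p ρ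

/-- The real tangent space `T_p S` of a real hypersurface: the vectors annihilated by the
differentials at `p` of the local defining functions (all of which have the same kernel). -/
def realTangentSpace (S : Set CPlane) (p : CPlane) : Submodule ℝ CPlane where
  carrier := {v | ∀ ρ : CPlane → ℝ, IsDefiningFunctionAt S p ρ → fderiv ℝ ρ p v = 0}
  zero_mem' := fun ρ _ => map_zero _
  add_mem' := fun ha hb ρ hρ => by rw [map_add, ha ρ hρ, hb ρ hρ, add_zero]
  smul_mem' := fun c v hv ρ hρ => by rw [map_smul, hv ρ hρ, smul_zero]

/-- The maximal complex subspace `H_p S = T_p S ∩ J (T_p S)` of the tangent space. -/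
def maximalComplexSubspace (S : Set CPlane) (p : CPlane) : Set CPlane :=
  {v | v ∈ realTangentSpace S p ∧ ∃ v' ∈ realTangentSpace S p, v = Complex.I • v'}

/-- The complexified tangent space `ℂ ⊗ T_p S`. -/
def complexifiedTangentSpace (S : Set CPlane) (p : CPlane) : Submodule ℂ CVec where
  carrier := {V | V.realPart ∈ realTangentSpace S p ∧ V.imagPart ∈ realTangentSpace S p}
  zero_mem' := by
    have h1 : CVec.realPart 0 = 0 := by ext j; simp [CVec.realPart]
    have h2 : CVec.imagPart 0 = 0 := by ext j; simp [CVec.imagPart]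
    exact ⟨h1 ▸ Submodule.zero_mem _, h2 ▸ Submodule.zero_mem _⟩
  add_mem' := by
    intro V W hV hW
    have h1 : CVec.realPart (V + W) = V.realPart + W.realPart := by
      ext j; simp [CVec.realPart]; ring
    have h2 : CVec.imagPart (V + W) = V.imagPart + W.imagPart := by
      ext j; simp [CVec.imagPart]; ring
    exact ⟨h1 ▸ Submodule.add_mem _ hV.1 hW.1, h2 ▸ Submodule.add_mem _ hV.2 hW.2⟩
  smul_mem' := by
    intro c V hV
    have hc : (c : ℂ) = c.re + c.im * Complex.I := (Complex.re_add_im c).symm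
    have hcc : conj c = (c.re : ℂ) - c.im * Complex.I := by
      apply Complex.ext <;> simp
    have hI : Complex.I ^ 2 = -1 := Complex.I_sq
    have h1 : CVec.realPart (c • V) = c.re • V.realPart - c.im • V.imagPart := by
      ext j
      simp only [CVec.realPart, CVec.imagPart, Prod.smul_fst, Prod.smul_snd, Pi.smul_apply,
        Pi.sub_apply, smul_eq_mul, map_mul, Complex.real_smul]
      rw [hcc]
      nth_rewrite 1 [hc]
      field_simp
      ring_nf
      rw [hI]
      ring
    have h2 : CVec.imagPart (c • V) = c.re • V.imagPart + c.im • V.realPart := by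
      ext j
      simp only [CVec.realPart, CVec.imagPart, Prod.smul_fst, Prod.smul_snd, Pi.smul_apply,
        Pi.add_apply, smul_eq_mul, map_mul, Complex.real_smul]
      rw [hcc]
      nth_rewrite 1 [hc]
      field_simp
      ring
    refine ⟨?_, ?_⟩
    · rw [h1]
      exact Submodule.sub_mem _ (Submodule.smul_mem _ _ hV.1) (Submodule.smul_mem _ _ hV.2)
    · rw [h2]
      exact Submodule.add_mem _ (Submodule.smul_mem _ _ hV.2) (Submodule.smul_mem _ _ hV.1)

/-- No complex tangent line `p + H_p S` of `S` passes through the origin. -/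
def NoComplexTangentLineThroughZero (S : Set CPlane) : Prop :=
  ∀ p ∈ S, ¬ ∃ v ∈ maximalComplexSubspace S p, p + v = 0

/-! ### Strong `ℂ`-convexity -/

/-- `S` is a strongly convex real hypersurface: the (real) Hessian of a suitable local defining
function is positive definite on the tangent space. -/
def IsStronglyConvexHypersurface (S : Set CPlane) : Prop :=
  IsRealHypersurface S ∧
    ∀ p ∈ S, ∃ ρ : CPlane → ℝ, IsDefiningFunctionAt S p ρ ∧
      ∀ v ∈ realTangentSpace S p, v ≠ 0 → 0 < fderiv ℝ (fderiv ℝ ρ) p v v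

/-- The homogeneous coordinates of the image of the point `(1 : z 0 : z 1)` under the projective
transformation of `ℂℙ²` given by the invertible matrix `M`. -/
def projectiveImage (M : GL (Fin 3) ℂ) (z : CPlane) : Fin 3 → ℂ :=
  Matrix.mulVec (M : Matrix (Fin 3) (Fin 3) ℂ) (Matrix.vecCons 1 z)

/-- The projective transformation given by `M` in the affine chart (meaningful where the zeroth
homogeneous coordinate of the image does not vanish). -/
def projectiveMap (M : GL (Fin 3) ℂ) (z : CPlane) : CPlane :=
  fun j => projectiveImage M z j.succ / projectiveImage M z 0

/-- `S` is strongly `ℂ`-convex: locally projectively equivalent to a strongly convex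
hypersurface. -/
def IsStronglyCConvex (S : Set CPlane) : Prop :=
  ∀ p ∈ S, ∃ U : Set CPlane, IsOpen U ∧ p ∈ U ∧ ∃ M : GL (Fin 3) ℂ,
    (∀ z ∈ S ∩ U, projectiveImage M z 0 ≠ 0) ∧
      IsStronglyConvexHypersurface (projectiveMap M '' (S ∩ U))

/-! ### Smooth functions and tangential vector fields on `S`

A function on `S` is represented by a function on `ℂ²` of which only the values on `S` are used;
it is smooth on `S` if it is `ContDiffOn ℝ ∞ _ S`. -/

/-- The derivative `V u` at `p ∈ S` of a function `u` on `S` along a complex tangent vector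
`V = A + i B` of `S`. Any two derivatives of `u` within `S` at `p` agree on `T_p S`. -/
def derivAlong (S : Set CPlane) (u : CPlane → ℂ) (p : CPlane) (V : CVec) : ℂ :=
  fderivWithin ℝ u S p V.realPart + Complex.I * fderivWithin ℝ u S p V.imagPart

/-- The function `X u` for a complex vector field `X` on `S` and a function `u` on `S`. -/
def fieldApply (S : Set CPlane) (X : CPlane → CVec) (u : CPlane → ℂ) : CPlane → ℂ :=
  fun p => derivAlong S u p (X p)

/-- `X` is a smooth tangential (complex) vector field on `S`. -/
def IsTangentialField (S : Set CPlane) (X : CPlane → CVec) : Prop :=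
  ContDiffOn ℝ ∞ X S ∧ ∀ p ∈ S, X p ∈ complexifiedTangentSpace S p

/-! ### CR structures and CR functions -/

/-- A CR structure of hypersurface type on the three-dimensional manifold `S`, given by its bundle
`L` of `(0,1)`-vectors: a smooth complex line subbundle of `ℂ ⊗ TS` that meets its conjugate only
in zero (integrability is automatic for a line bundle). -/
structure IsCRStructure (S : Set CPlane) (L : CPlane → Submodule ℂ CVec) : Prop where
  tangential : ∀ p ∈ S, L p ≤ complexifiedTangentSpace S p
  line_bundle : ∀ p ∈ S, ∃ U : Set CPlane, IsOpen U ∧ p ∈ U ∧ ∃ V : CPlane → CVec,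
    ContDiffOn ℝ ∞ V (S ∩ U) ∧ ∀ q ∈ S ∩ U, V q ≠ 0 ∧ L q = Submodule.span ℂ {V q}
  disjoint_conjugate : ∀ p ∈ S, ∀ V ∈ L p, V.conjugate ∈ L p → V = 0

/-- The smooth function `f` on `S` is CR for the CR structure with `(0,1)`-bundle `L`. -/
def IsCRFor (S : Set CPlane) (L : CPlane → Submodule ℂ CVec) (f : CPlane → ℂ) : Prop :=
  ContDiffOn ℝ ∞ f S ∧ ∀ p ∈ S, ∀ V ∈ L p, derivAlong S f p V = 0

/-- The standard CR structure: the tangential vectors `∑ j, b j ∂/∂z̄_j`. -/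
def standardCRStructure (S : Set CPlane) (p : CPlane) : Submodule ℂ CVec :=
  complexifiedTangentSpace S p ⊓ LinearMap.ker (LinearMap.fst ℂ CPlane CPlane)

/-- The Wirtinger derivative `∂ρ/∂z_j` of a real-valued function. -/
def wirtingerDeriv (ρ : CPlane → ℝ) (j : Fin 2) (p : CPlane) : ℂ :=
  ((fderiv ℝ ρ p (Pi.single j 1) : ℝ) - Complex.I * (fderiv ℝ ρ p (Pi.single j Complex.I) : ℝ)) / 2

open Classical in
/-- The functions `w_j = (∂ρ/∂z_j) / (z_1 ∂ρ/∂z_1 + z_2 ∂ρ/∂z_2)` on `S`, where `ρ` is any local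
defining function of `S` (the value does not depend on the choice). -/
def dualCoord (S : Set CPlane) (j : Fin 2) (p : CPlane) : ℂ :=
  if h : ∃ ρ : CPlane → ℝ, IsDefiningFunctionAt S p ρ then
    wirtingerDeriv h.choose j p / ∑ k, p k * wirtingerDeriv h.choose k p
  else 0

/-- `L` is the projective dual CR structure: the CR structure for which the `w_j` are CR. -/
def IsDualCRStructure (S : Set CPlane) (L : CPlane → Submodule ℂ CVec) : Prop :=
  IsCRStructure S L ∧ ∀ j, IsCRFor S L (dualCoord S j)

/-- `f` is a (smooth) CR function on `S`. -/
def IsCRFunction (S : Set CPlane) (f : CPlane → ℂ) : Prop :=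
  IsCRFor S (standardCRStructure S) f

/-- `g` is a (smooth) dual-CR function on `S`. -/
def IsDualCRFunction (S : Set CPlane) (g : CPlane → ℂ) : Prop :=
  ∃ L, IsDualCRStructure S L ∧ IsCRFor S L g

/-! ### The vector fields `X` and `T` -/

/-- `X` is a smooth tangential vector field on `S` with
`X z_1 = X z_2 = 0`, `X w_1 = z_2`, `X w_2 = -z_1`. -/
structure IsFieldX (S : Set CPlane) (X : CPlane → CVec) : Prop where
  tangential : IsTangentialField S X
  apply_z : ∀ j, ∀ p ∈ S, fieldApply S X (fun z => z j) p = 0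
  apply_w0 : ∀ p ∈ S, fieldApply S X (dualCoord S 0) p = p 1
  apply_w1 : ∀ p ∈ S, fieldApply S X (dualCoord S 1) p = -p 0

/-- `T` is a smooth tangential vector field on `S` with
`T z_1 = w_2`, `T z_2 = -w_1`, `T w_1 = T w_2 = 0`. -/
structure IsFieldT (S : Set CPlane) (T : CPlane → CVec) : Prop where
  tangential : IsTangentialField S T
  apply_z0 : ∀ p ∈ S, fieldApply S T (fun z => z 0) p = dualCoord S 1 p
  apply_z1 : ∀ p ∈ S, fieldApply S T (fun z => z 1) p = -dualCoord S 0 p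
  apply_w : ∀ j, ∀ p ∈ S, fieldApply S T (dualCoord S j) p = 0

end

/-!
On `S` one has `z_1 w_1 + z_2 w_2 = 1`, and strong `ℂ`-convexity makes the second fundamental form
definite on the maximal complex subspace `H`. Projective maps preserve this property because they
send lines to lines (`IsStronglyCConvex.exists_hessian_pos`). Since the derivatives of the `w_j`
along `H` are given by the Hessian of a defining function (`sum_fderivWithin_dualCoord_mul`), it
follows that `(w_1, w_2)` is an immersion of `S` (`eq_zero_of_fderivWithin_dualCoord`) and that
`z_1, z_2, w_1, w_2` separate complex tangent vectors (`eq_zero_of_derivAlong_dualCoord`). The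
second fact gives existence and uniqueness of `X` and `T`, the first shows that the lines spanned
by `T` form a CR structure. A function is CR if and only if it is annihilated by `X`, and dual-CR
if and only if it is annihilated by `T` (`isCRFunction_iff`, `isDualCRFunction_iff`).

Let `Y = [X, T]`. Evaluation on `z_j` and `w_j` shows that `Y z_j = -z_j`, `Y w_j = w_j`,
`[X, Y] = 2 X` and `[T, Y] = -2 T`, and that `X, T, Y` is a frame. If `X f = 0`, then
`X X T f = X Y f = Y X f + 2 X f = 0`, and in the same way `T T X g = 0` if `T g = 0`; this is one
implication. Conversely, given `u`, a CR function `f` such that `u - f` is dual-CR has to satisfy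
`X f = 0`, `T f = T u` and `Y f = X T u`. These equations prescribe `df` as a form
`a_1 dz_1 + a_2 dz_2`, and `X X T u = 0 = T T X u` says exactly that this form is closed. As `S` is
simply connected, it is exact (`IsRealHypersurface.exists_primitive`).

The calculus on `S` is done through smooth local retractions `π` onto `S`: a function `u` that is
smooth on `S` extends locally to the smooth function `u ∘ π`.
-/

/-! ### Local retractions onto a hypersurface -/

/-- `π` is a smooth retraction of the convex open set `W` onto a part of `S` that contains `S ∩ W`.
The image of `π` is not required to lie in `W`. -/
structure IsLocalRetraction (S W : Set CPlane) (π : CPlane → CPlane) : Prop where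
  isOpen : IsOpen W
  convex : Convex ℝ W
  smooth : ContDiffOn ℝ ∞ π W
  mapsTo : Set.MapsTo π W S
  eq_self : ∀ q ∈ S ∩ W, π q = q
  fderiv_apply : ∀ q ∈ S ∩ W, ∀ v ∈ realTangentSpace S q, fderiv ℝ π q v = v

theorem IsDefiningFunctionOn.at {S U : Set CPlane} {ρ : CPlane → ℝ}
    (h : IsDefiningFunctionOn S U ρ) {p : CPlane} (hp : p ∈ U) : IsDefiningFunctionAt S p ρ :=
  ⟨U, hp, h⟩

/-- Near a point of `S` with defining function `ρ`, the map `q ↦ q + (ρ q - ℓ (q - p)) v₀`, where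
`ℓ = dρ(p)` and `ℓ v₀ = 1`, is a local diffeomorphism that flattens `S` to the hyperplane
`p + ker ℓ`. Composing the linear projection onto this hyperplane with the inverse of the
diffeomorphism gives the retraction. -/
theorem IsDefiningFunctionAt.exists_retraction {S : Set CPlane} {p : CPlane} (hp : p ∈ S)
    {ρ : CPlane → ℝ} (hρ : IsDefiningFunctionAt S p ρ) {N : Set CPlane} (hN : N ∈ nhds p) :
    ∃ W π, p ∈ W ∧ W ⊆ N ∧ Set.MapsTo π W N ∧ IsLocalRetraction S W π ∧
      ∀ v, fderiv ℝ ρ p v = 0 → fderiv ℝ π p v = v := by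
  obtain ⟨U, hpU, hρ⟩ := hρ
  set ℓ := fderiv ℝ ρ p with hℓ
  have hρC : ∀ q ∈ U, ContDiffAt ℝ ∞ ρ q := fun q hq =>
    hρ.smooth.contDiffAt (hρ.isOpen.mem_nhds hq)
  obtain ⟨v0, hv0⟩ : ∃ v0, ℓ v0 = 1 := by
    have h := hρ.fderiv_ne_zero p ⟨hp, hpU⟩
    obtain ⟨v, hv⟩ : ∃ v, ℓ v ≠ 0 := by
      by_contra! hc
      exact h (by ext v; simpa using hc v)
    exact ⟨(ℓ v)⁻¹ • v, by simp [hv]⟩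
  let Ψ : CPlane → CPlane := fun q => q + (ρ q - ℓ (q - p)) • v0
  let P : CPlane → CPlane := fun q => q - (ℓ (q - p)) • v0
  have hΨC : ∀ q ∈ U, ContDiffAt ℝ ∞ Ψ q := fun q hq => by
    have := hρC q hq
    fun_prop
  have hPC : ContDiff ℝ ∞ P := by fun_prop
  have hΨD : ∀ q ∈ U, HasFDerivAt Ψ (ContinuousLinearMap.id ℝ CPlane +
      (fderiv ℝ ρ q - ℓ).smulRight v0) q := fun q hq => by
    have h1 : HasFDerivAt ρ (fderiv ℝ ρ q) q :=
      ((hρC q hq).differentiableAt (by simp)).hasFDerivAt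
    have h2 : HasFDerivAt (fun q => ℓ (q - p)) ℓ q :=
      ℓ.hasFDerivAt.comp q ((hasFDerivAt_id q).sub_const p)
    exact (hasFDerivAt_id q).add ((h1.sub h2).smul_const v0)
  have hPD : ∀ q, HasFDerivAt P (ContinuousLinearMap.id ℝ CPlane - ℓ.smulRight v0) q := fun q => by
    have h2 : HasFDerivAt (fun q => ℓ (q - p)) ℓ q :=
      ℓ.hasFDerivAt.comp q ((hasFDerivAt_id q).sub_const p)
    exact (hasFDerivAt_id q).sub (h2.smul_const v0)
  have hΨp : HasFDerivAt Ψ ((ContinuousLinearEquiv.refl ℝ CPlane : CPlane ≃L[ℝ] CPlane) :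
      CPlane →L[ℝ] CPlane) p := by
    convert hΨD p hpU using 1
    ext v
    simp [hℓ]
  have hρp : ρ p = 0 := (hρ.zero_iff p hpU).1 hp
  have hΨpp : Ψ p = p := by simp [Ψ, hρp]
  have hPp : P p = p := by simp [P]
  let e := (hΨC p hpU).toOpenPartialHomeomorph Ψ hΨp (by simp)
  have hpe : p ∈ e.source := ContDiffAt.mem_toOpenPartialHomeomorph_source _ _ _
  have hee : ∀ q, e q = Ψ q := fun q => rfl
  let Q : Set CPlane := {q | q ∈ N ∧ q ∈ e.source ∧ q ∈ U ∧
    fderiv ℝ Ψ q ∈ Set.range ((↑) : (CPlane ≃L[ℝ] CPlane) → CPlane →L[ℝ] CPlane)}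
  have hQ : Q ∈ nhds p := by
    refine Filter.inter_mem hN (Filter.inter_mem (e.open_source.mem_nhds hpe)
      (Filter.inter_mem (hρ.isOpen.mem_nhds hpU) ?_))
    have hc : ContinuousAt (fderiv ℝ Ψ) p :=
      ((hΨC p hpU).fderiv_right (m := ∞) (by simp)).continuousAt
    exact hc.preimage_mem_nhds (hΨp.fderiv ▸ ContinuousLinearEquiv.nhds _)
  have hmem : {q | q ∈ Q ∧ P q ∈ e.target ∧ e.symm (P q) ∈ Q} ∈ nhds p := by
    have hpt : P p ∈ e.target := by
      rw [hPp]; rw [← hΨpp]; exact e.map_source hpe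
    refine Filter.inter_mem hQ (Filter.inter_mem
      (hPC.continuous.continuousAt (e.open_target.mem_nhds hpt)) ?_)
    have hc : ContinuousAt (fun q => e.symm (P q)) p :=
      ContinuousAt.comp (e.continuousAt_symm hpt) hPC.continuous.continuousAt
    have : e.symm (P p) = p := by
      conv_rhs => rw [← e.left_inv hpe]
      rw [hee, hΨpp, hPp]
    exact hc.preimage_mem_nhds (this.symm ▸ hQ)
  obtain ⟨r, hr, hrs⟩ := Metric.mem_nhds_iff.1 hmem
  have hsymm : ∀ q ∈ Metric.ball p r, ContDiffAt ℝ ∞ e.symm (P q) := fun q hq => by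
    obtain ⟨-, hPt, -, -, hxU, A, hA⟩ := hrs hq
    refine e.contDiffAt_symm (f₀' := A) hPt ?_ (hΨC _ hxU)
    rw [hA]
    exact (hΨD _ hxU).differentiableAt.hasFDerivAt
  have hker : ∀ q ∈ S ∩ Metric.ball p r, ∀ v, fderiv ℝ ρ q v = 0 →
      fderiv ℝ (fun q => e.symm (P q)) q v = v := by
    rintro q ⟨hqS, hq⟩ v hρv
    obtain ⟨⟨-, hqs, hqU, -⟩, -⟩ := hrs hq
    have hPΨ : P q = Ψ q := by simp only [P, Ψ, (hρ.zero_iff q hqU).1 hqS]; module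
    have h1 : HasFDerivAt e.symm (fderiv ℝ e.symm (P q)) (P q) :=
      ((hsymm q hq).differentiableAt (by simp)).hasFDerivAt
    have h2 := h1.comp q (hPD q)
    have h3 := (hPΨ ▸ h1 : HasFDerivAt e.symm (fderiv ℝ e.symm (P q)) (Ψ q)).comp q (hΨD q hqU)
    have h4 : HasFDerivAt (e.symm ∘ Ψ) (ContinuousLinearMap.id ℝ CPlane) q := by
      refine (hasFDerivAt_id q).congr_of_eventuallyEq ?_
      filter_upwards [e.open_source.mem_nhds hqs] with x hx using e.left_inv hx
    have h5 := congrArg (fun A => A v) (h3.unique h4)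
    have h6 : fderiv ℝ (fun q => e.symm (P q)) q v = _ := congrArg (fun A => A v) h2.fderiv
    rw [h6]
    simp [hρv] at h5 ⊢
    rw [← sub_eq_add_neg] at h5
    simpa using h5
  refine ⟨Metric.ball p r, fun q => e.symm (P q), Metric.mem_ball_self hr,
    fun q hq => (hrs hq).1.1, fun q hq => (hrs hq).2.2.1, ⟨Metric.isOpen_ball,
    convex_ball p r, ?_, ?_, ?_, fun q hq v hv => hker q hq v (hv ρ (hρ.at (hrs hq.2).1.2.2.1))⟩,
    hker p ⟨hp, Metric.mem_ball_self hr⟩⟩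
  · exact fun q hq => ((hsymm q hq).comp q hPC.contDiffAt).contDiffWithinAt
  · intro q hq
    obtain ⟨-, hPt, -, -, hxU, -⟩ := hrs hq
    rw [hρ.zero_iff _ hxU]
    have h1 : Ψ (e.symm (P q)) = P q := e.right_inv hPt
    have h2 : ∀ x, ℓ (Ψ x - p) = ρ x := fun x => by
      simp only [Ψ, map_sub, map_add, map_smul, hv0]; simp; ring
    rw [← h2, h1]
    simp only [P, map_sub, map_smul, hv0]; simp
  · rintro q ⟨hqS, hq⟩
    obtain ⟨⟨-, hqs, hqU, -⟩, -⟩ := hrs hq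
    have : P q = Ψ q := by simp only [P, Ψ, (hρ.zero_iff q hqU).1 hqS]; module
    simp only [this]
    exact e.left_inv hqs

theorem IsRealHypersurface.exists_retraction {S : Set CPlane} (hS : IsRealHypersurface S)
    {p : CPlane} (hp : p ∈ S) {N : Set CPlane} (hN : N ∈ nhds p) :
    ∃ W π, p ∈ W ∧ W ⊆ N ∧ Set.MapsTo π W N ∧ IsLocalRetraction S W π := by
  obtain ⟨ρ, hρ⟩ := hS p hp
  obtain ⟨W, π, h1, h2, h3, h4, -⟩ := hρ.exists_retraction hp hN
  exact ⟨W, π, h1, h2, h3, h4⟩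

theorem IsLocalRetraction.mem_realTangentSpace {S W : Set CPlane} {π : CPlane → CPlane}
    (h : IsLocalRetraction S W π) {q : CPlane} (hq : q ∈ W) (v : CPlane) :
    fderiv ℝ π q v ∈ realTangentSpace S (π q) := by
  rintro ρ ⟨U, hU, hρ⟩
  have hπ := (h.smooth.contDiffAt (h.isOpen.mem_nhds hq))
  have h1 : HasFDerivAt π (fderiv ℝ π q) q := (hπ.differentiableAt (by simp)).hasFDerivAt
  have h2 : HasFDerivAt ρ (fderiv ℝ ρ (π q)) (π q) :=
    ((hρ.smooth.contDiffAt (hρ.isOpen.mem_nhds hU)).differentiableAt (by simp)).hasFDerivAt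
  have h3 : HasFDerivAt (ρ ∘ π) (0 : CPlane →L[ℝ] ℝ) q := by
    refine (hasFDerivAt_const (0 : ℝ) q).congr_of_eventuallyEq ?_
    filter_upwards [h.isOpen.mem_nhds hq, hπ.continuousAt (hρ.isOpen.mem_nhds hU)] with x hx hx'
    exact (hρ.zero_iff _ hx').1 (h.mapsTo hx)
  simpa using congrArg (fun A => A v) ((h2.comp q h1).unique h3)

/-- The derivative along `S` of a function on `S` can be computed through any local retraction. -/
theorem IsLocalRetraction.hasFDerivWithinAt_apply {S W : Set CPlane} {π : CPlane → CPlane}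
    (h : IsLocalRetraction S W π) {q : CPlane} (hq : q ∈ S ∩ W) {F : Type*}
    [NormedAddCommGroup F] [NormedSpace ℝ F] {u : CPlane → F} {u' : CPlane →L[ℝ] F}
    (hu : HasFDerivWithinAt u u' S q) {v : CPlane} (hv : v ∈ realTangentSpace S q) :
    fderiv ℝ (fun x => u (π x)) q v = u' v := by
  have hπ := (h.smooth.contDiffAt (h.isOpen.mem_nhds hq.2))
  have h1 : HasFDerivWithinAt π (fderiv ℝ π q) W q :=
    (hπ.differentiableAt (by simp)).hasFDerivAt.hasFDerivWithinAt
  have h2 : HasFDerivWithinAt u u' S (π q) := by rwa [h.eq_self q hq]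
  have h3 := (h2.comp q h1 h.mapsTo).hasFDerivAt (h.isOpen.mem_nhds hq.2)
  have := congrArg (fun A => A v) h3.fderiv
  simpa [Function.comp_def, h.fderiv_apply q hq v hv] using this

theorem IsRealHypersurface.fderivWithin_apply {S : Set CPlane} (hS : IsRealHypersurface S)
    {p : CPlane} (hp : p ∈ S) {F : Type*}
    [NormedAddCommGroup F] [NormedSpace ℝ F] {u : CPlane → F} {u' : CPlane →L[ℝ] F}
    (hu : HasFDerivWithinAt u u' S p) {v : CPlane} (hv : v ∈ realTangentSpace S p) :
    fderivWithin ℝ u S p v = u' v := by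
  obtain ⟨W, π, hpW, -, -, h⟩ := hS.exists_retraction hp Filter.univ_mem
  rw [← h.hasFDerivWithinAt_apply ⟨hp, hpW⟩ hu hv,
    ← h.hasFDerivWithinAt_apply ⟨hp, hpW⟩ hu.differentiableWithinAt.hasFDerivWithinAt hv]

/-- The tangent space is the kernel of the differential of a single defining function. -/
theorem IsDefiningFunctionAt.mem_realTangentSpace_iff {S : Set CPlane} {p : CPlane} (hp : p ∈ S)
    {ρ : CPlane → ℝ} (hρ : IsDefiningFunctionAt S p ρ) {v : CPlane} :
    v ∈ realTangentSpace S p ↔ fderiv ℝ ρ p v = 0 := by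
  refine ⟨fun hv => hv ρ hρ, fun hv => ?_⟩
  obtain ⟨W, π, hpW, -, -, h, hker⟩ := hρ.exists_retraction hp Filter.univ_mem
  have := h.mem_realTangentSpace hpW v
  rwa [hker v hv, h.eq_self p ⟨hp, hpW⟩] at this

/-! ### Complex tangent vectors as derivations -/

theorem CVec.realPart_smul (c : ℂ) (V : CVec) :
    CVec.realPart (c • V) = c.re • V.realPart - c.im • V.imagPart := by
  have hI : Complex.I ^ 2 = -1 := Complex.I_sq
  have hcc : conj c = (c.re : ℂ) - c.im * Complex.I := by
    apply Complex.ext <;> simp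
  ext j
  simp only [CVec.realPart, CVec.imagPart, Prod.smul_fst, Prod.smul_snd, Pi.smul_apply,
    Pi.sub_apply, smul_eq_mul, map_mul, Complex.real_smul]
  rw [hcc]
  nth_rewrite 1 [← Complex.re_add_im c]
  field_simp
  ring_nf
  rw [hI]
  ring

theorem CVec.imagPart_smul (c : ℂ) (V : CVec) :
    CVec.imagPart (c • V) = c.re • V.imagPart + c.im • V.realPart := by
  have hcc : conj c = (c.re : ℂ) - c.im * Complex.I := by
    apply Complex.ext <;> simp
  ext j
  simp only [CVec.realPart, CVec.imagPart, Prod.smul_fst, Prod.smul_snd, Pi.smul_apply,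
    Pi.add_apply, smul_eq_mul, map_mul, Complex.real_smul]
  rw [hcc]
  nth_rewrite 1 [← Complex.re_add_im c]
  field_simp
  ring

/-- `CVec.realPart` as a continuous real-linear map. -/
noncomputable def CVec.realPartL : CVec →L[ℝ] CPlane := LinearMap.toContinuousLinearMap
  { toFun := CVec.realPart
    map_add' := fun V W => by ext j; simp [CVec.realPart]; ring
    map_smul' := fun c V => by simpa using CVec.realPart_smul (c : ℂ) V }

/-- `CVec.imagPart` as a continuous real-linear map. -/
noncomputable def CVec.imagPartL : CVec →L[ℝ] CPlane := LinearMap.toContinuousLinearMap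
  { toFun := CVec.imagPart
    map_add' := fun V W => by ext j; simp [CVec.imagPart]; ring
    map_smul' := fun c V => by simpa using CVec.imagPart_smul (c : ℂ) V }

@[simp] theorem CVec.realPartL_apply (V : CVec) : CVec.realPartL V = V.realPart := rfl

@[simp] theorem CVec.imagPartL_apply (V : CVec) : CVec.imagPartL V = V.imagPart := rfl

theorem CVec.realPart_add_I_smul_imagPart (V : CVec) :
    V.realPart + Complex.I • V.imagPart = V.1 := by
  ext j
  simp [CVec.realPart, CVec.imagPart]
  field_simp
  ring

/-- The value `L A + i L B` of the complex-linear extension of the real-linear form `L` at the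
complex tangent vector `A + i B`. -/
noncomputable def complexify (L : CPlane →L[ℝ] ℂ) (V : CVec) : ℂ :=
  L V.realPart + Complex.I * L V.imagPart

theorem complexify_add (L : CPlane →L[ℝ] ℂ) (V W : CVec) :
    complexify L (V + W) = complexify L V + complexify L W := by
  simp only [complexify, ← CVec.realPartL_apply, ← CVec.imagPartL_apply, map_add]
  ring

theorem complexify_smul (L : CPlane →L[ℝ] ℂ) (c : ℂ) (V : CVec) :
    complexify L (c • V) = c * complexify L V := by
  simp only [complexify, CVec.realPart_smul, CVec.imagPart_smul, map_add, map_sub, map_smul,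
    Complex.real_smul]
  conv_rhs => rw [← Complex.re_add_im c]
  linear_combination (-(c.im : ℂ) * L V.imagPart) * Complex.I_sq

theorem complexify_sub (L : CPlane →L[ℝ] ℂ) (V W : CVec) :
    complexify L (V - W) = complexify L V - complexify L W := by
  rw [sub_eq_add_neg, complexify_add, ← neg_one_smul ℂ W, complexify_smul]
  ring

theorem derivAlong_eq_complexify (S : Set CPlane) (u : CPlane → ℂ) (p : CPlane) (V : CVec) :
    derivAlong S u p V = complexify (fderivWithin ℝ u S p) V := rfl

theorem derivAlong_add_vec (S : Set CPlane) (u : CPlane → ℂ) (p : CPlane) (V W : CVec) :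
    derivAlong S u p (V + W) = derivAlong S u p V + derivAlong S u p W :=
  complexify_add _ _ _

theorem derivAlong_sub_vec (S : Set CPlane) (u : CPlane → ℂ) (p : CPlane) (V W : CVec) :
    derivAlong S u p (V - W) = derivAlong S u p V - derivAlong S u p W :=
  complexify_sub _ _ _

theorem derivAlong_smul_vec (S : Set CPlane) (u : CPlane → ℂ) (p : CPlane) (c : ℂ) (V : CVec) :
    derivAlong S u p (c • V) = c * derivAlong S u p V :=
  complexify_smul _ _ _

theorem derivAlong_congr {S : Set CPlane} {u v : CPlane → ℂ} (h : Set.EqOn u v S) {p : CPlane}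
    (hp : p ∈ S) (V : CVec) : derivAlong S u p V = derivAlong S v p V := by
  rw [derivAlong_eq_complexify, derivAlong_eq_complexify, fderivWithin_congr h (h hp)]

theorem derivAlong_eq {S : Set CPlane} (hS : IsRealHypersurface S) {p : CPlane} (hp : p ∈ S)
    {u : CPlane → ℂ} {u' : CPlane →L[ℝ] ℂ} (hu : HasFDerivWithinAt u u' S p)
    {V : CVec} (hV : V ∈ complexifiedTangentSpace S p) :
    derivAlong S u p V = complexify u' V := by
  rw [derivAlong, hS.fderivWithin_apply hp hu hV.1, hS.fderivWithin_apply hp hu hV.2, complexify]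

theorem derivAlong_fst {S : Set CPlane} (hS : IsRealHypersurface S) {p : CPlane} (hp : p ∈ S)
    {V : CVec} (hV : V ∈ complexifiedTangentSpace S p) (j : Fin 2) :
    derivAlong S (fun z => z j) p V = V.1 j := by
  have h : HasFDerivWithinAt (fun z : CPlane => z j) (ContinuousLinearMap.proj j) S p :=
    (ContinuousLinearMap.proj (R := ℝ) (φ := fun _ : Fin 2 => ℂ) j).hasFDerivWithinAt
  rw [derivAlong_eq hS hp h hV, ← V.realPart_add_I_smul_imagPart]
  simp [complexify]

theorem derivAlong_const {S : Set CPlane} (hS : IsRealHypersurface S) {p : CPlane} (hp : p ∈ S)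
    (c : ℂ) {V : CVec} (hV : V ∈ complexifiedTangentSpace S p) :
    derivAlong S (fun _ => c) p V = 0 := by
  rw [derivAlong_eq hS hp (hasFDerivWithinAt_const c p S) hV]
  simp [complexify]

theorem derivAlong_add {S : Set CPlane} (hS : IsRealHypersurface S) {p : CPlane} (hp : p ∈ S)
    {u v : CPlane → ℂ} (hu : ContDiffOn ℝ ∞ u S) (hv : ContDiffOn ℝ ∞ v S)
    {V : CVec} (hV : V ∈ complexifiedTangentSpace S p) :
    derivAlong S (fun q => u q + v q) p V = derivAlong S u p V + derivAlong S v p V := by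
  have hu' := ((hu.differentiableOn (by simp)) p hp).hasFDerivWithinAt
  have hv' := ((hv.differentiableOn (by simp)) p hp).hasFDerivWithinAt
  refine (derivAlong_eq hS hp (hu'.add hv') hV).trans ?_
  simp only [derivAlong, complexify, add_apply]
  ring

theorem derivAlong_mul {S : Set CPlane} (hS : IsRealHypersurface S) {p : CPlane} (hp : p ∈ S)
    {u v : CPlane → ℂ} (hu : ContDiffOn ℝ ∞ u S) (hv : ContDiffOn ℝ ∞ v S)
    {V : CVec} (hV : V ∈ complexifiedTangentSpace S p) :
    derivAlong S (fun q => u q * v q) p V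
      = u p * derivAlong S v p V + v p * derivAlong S u p V := by
  have hu' := ((hu.differentiableOn (by simp)) p hp).hasFDerivWithinAt
  have hv' := ((hv.differentiableOn (by simp)) p hp).hasFDerivWithinAt
  refine (derivAlong_eq hS hp (hu'.mul hv') hV).trans ?_
  simp only [derivAlong, complexify, add_apply, smul_apply, smul_eq_mul]
  ring

theorem derivAlong_neg {S : Set CPlane} (hS : IsRealHypersurface S) {p : CPlane} (hp : p ∈ S)
    {u : CPlane → ℂ} (hu : ContDiffOn ℝ ∞ u S)
    {V : CVec} (hV : V ∈ complexifiedTangentSpace S p) :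
    derivAlong S (fun q => -u q) p V = -derivAlong S u p V := by
  have := derivAlong_mul hS hp (contDiffOn_const (c := (-1 : ℂ))) hu hV
  simpa [derivAlong_const hS hp _ hV] using this

theorem derivAlong_sub {S : Set CPlane} (hS : IsRealHypersurface S) {p : CPlane} (hp : p ∈ S)
    {u v : CPlane → ℂ} (hu : ContDiffOn ℝ ∞ u S) (hv : ContDiffOn ℝ ∞ v S)
    {V : CVec} (hV : V ∈ complexifiedTangentSpace S p) :
    derivAlong S (fun q => u q - v q) p V = derivAlong S u p V - derivAlong S v p V := by
  simpa [derivAlong_neg hS hp hv hV, sub_eq_add_neg] using derivAlong_add hS hp hu hv.neg hV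

theorem IsLocalRetraction.contDiffOn_comp {S W : Set CPlane} {π : CPlane → CPlane}
    (h : IsLocalRetraction S W π) {F : Type*} [NormedAddCommGroup F] [NormedSpace ℝ F]
    {u : CPlane → F} (hu : ContDiffOn ℝ ∞ u S) : ContDiffOn ℝ ∞ (fun x => u (π x)) W :=
  hu.comp h.smooth h.mapsTo

theorem IsLocalRetraction.contDiffAt_comp {S W : Set CPlane} {π : CPlane → CPlane}
    (h : IsLocalRetraction S W π) {F : Type*} [NormedAddCommGroup F] [NormedSpace ℝ F]
    {u : CPlane → F} (hu : ContDiffOn ℝ ∞ u S) {q : CPlane} (hq : q ∈ W) :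
    ContDiffAt ℝ ∞ (fun x => u (π x)) q :=
  (h.contDiffOn_comp hu).contDiffAt (h.isOpen.mem_nhds hq)

theorem IsLocalRetraction.derivAlong_eq {S W : Set CPlane} {π : CPlane → CPlane}
    (h : IsLocalRetraction S W π) {u : CPlane → ℂ} (hu : ContDiffOn ℝ ∞ u S) {q : CPlane}
    (hq : q ∈ S ∩ W) {V : CVec} (hV : V ∈ complexifiedTangentSpace S q) :
    derivAlong S u q V = complexify (fderiv ℝ (fun x => u (π x)) q) V := by
  have hu' := ((hu.differentiableOn (by simp)) q hq.1).hasFDerivWithinAt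
  rw [complexify, h.hasFDerivWithinAt_apply hq hu' hV.1, h.hasFDerivWithinAt_apply hq hu' hV.2]
  rfl

theorem contDiffOn_complexify {W : Set CPlane} {L : CPlane → CPlane →L[ℝ] ℂ} {V : CPlane → CVec}
    (hL : ContDiffOn ℝ ∞ L W) (hV : ContDiffOn ℝ ∞ V W) :
    ContDiffOn ℝ ∞ (fun q => complexify (L q) (V q)) W :=
  (hL.clm_apply (CVec.realPartL.contDiff.comp_contDiffOn hV)).add
    (contDiffOn_const.mul (hL.clm_apply (CVec.imagPartL.contDiff.comp_contDiffOn hV)))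

theorem contDiffOn_fieldApply {S : Set CPlane} (hS : IsRealHypersurface S) {X : CPlane → CVec}
    (hX : IsTangentialField S X) {u : CPlane → ℂ} (hu : ContDiffOn ℝ ∞ u S) :
    ContDiffOn ℝ ∞ (fieldApply S X u) S := by
  intro p hp
  obtain ⟨W, π, hpW, -, -, h⟩ := hS.exists_retraction hp Filter.univ_mem
  have hg : ContDiffOn ℝ ∞ (fun q => complexify (fderiv ℝ (fun x => u (π x)) q) (X q)) (S ∩ W) :=
    contDiffOn_complexify (((h.contDiffOn_comp hu).fderiv_of_isOpen h.isOpen (by simp)).mono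
      Set.inter_subset_right) (hX.1.mono Set.inter_subset_left)
  refine ((hg.congr fun q hq => h.derivAlong_eq hu hq (hX.2 q hq.1)) p
    ⟨hp, hpW⟩).mono_of_mem_nhdsWithin ?_
  exact inter_mem_nhdsWithin S (h.isOpen.mem_nhds hpW)

/-! ### The Lie bracket of tangential fields -/

/-- The bracket `[A, B]` of the vector fields `A`, `B` on an open set acts on functions as the
commutator. -/
theorem complexify_commutator {g : CPlane → ℂ} {A B : CPlane → CVec} {p : CPlane}
    (hg : ContDiffAt ℝ ∞ g p) (hA : DifferentiableAt ℝ A p) (hB : DifferentiableAt ℝ B p) :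
    complexify (fderiv ℝ (fun q => complexify (fderiv ℝ g q) (B q)) p) (A p)
      - complexify (fderiv ℝ (fun q => complexify (fderiv ℝ g q) (A q)) p) (B p)
    = complexify (fderiv ℝ g p)
        ((fderiv ℝ B p (A p).realPart + Complex.I • fderiv ℝ B p (A p).imagPart)
          - (fderiv ℝ A p (B p).realPart + Complex.I • fderiv ℝ A p (B p).imagPart)) := by
  have hD : HasFDerivAt (fderiv ℝ g) (fderiv ℝ (fderiv ℝ g) p) p :=
    ((hg.fderiv_right (m := ∞) (by simp)).differentiableAt (by simp)).hasFDerivAt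
  have hsymm : ∀ v w, fderiv ℝ (fderiv ℝ g) p v w = fderiv ℝ (fderiv ℝ g) p w v :=
    fun v w => (hg.isSymmSndFDerivAt (by
      rw [minSmoothness_of_isRCLikeNormedField]; exact WithTop.coe_le_coe.2 le_top)).eq v w
  have key : ∀ {C : CPlane → CVec}, DifferentiableAt ℝ C p → ∀ v,
      fderiv ℝ (fun q => complexify (fderiv ℝ g q) (C q)) p v
        = complexify (fderiv ℝ (fderiv ℝ g) p v) (C p)
          + complexify (fderiv ℝ g p) (fderiv ℝ C p v) := by
    intro C hC v
    have h1 := hD.clm_apply (CVec.realPartL.hasFDerivAt.comp p hC.hasFDerivAt)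
    have h2 := hD.clm_apply (CVec.imagPartL.hasFDerivAt.comp p hC.hasFDerivAt)
    have h3 := congrArg (fun M => M v) (h1.add (h2.const_mul Complex.I)).fderiv
    simp only [Function.comp_def, CVec.realPartL_apply, CVec.imagPartL_apply] at h3
    refine h3.trans ?_
    simp [complexify]
    ring
  simp only [complexify_sub, complexify_add, complexify_smul]
  rw [complexify, complexify, key hA, key hA, key hB, key hB]
  simp only [complexify, hsymm (B p).realPart, hsymm (B p).imagPart]
  ring

/-- The Lie bracket `[X, T]` of two fields on `S`: its components are the values of the commutator
of `X` and `T` on the components of the fields. -/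
noncomputable def fieldBracket (S : Set CPlane) (X T : CPlane → CVec) : CPlane → CVec := fun p =>
  (fun j => fieldApply S X (fun q => (T q).1 j) p - fieldApply S T (fun q => (X q).1 j) p,
   fun j => fieldApply S X (fun q => (T q).2 j) p - fieldApply S T (fun q => (X q).2 j) p)

theorem IsLocalRetraction.fieldBracket_eq {S W : Set CPlane} {π : CPlane → CPlane}
    (h : IsLocalRetraction S W π) {X T : CPlane → CVec}
    (hX : IsTangentialField S X) (hT : IsTangentialField S T) {p : CPlane} (hp : p ∈ S ∩ W) :
    fieldBracket S X T p =
      (fderiv ℝ (fun x => T (π x)) p (X p).realPart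
          + Complex.I • fderiv ℝ (fun x => T (π x)) p (X p).imagPart)
        - (fderiv ℝ (fun x => X (π x)) p (T p).realPart
          + Complex.I • fderiv ℝ (fun x => X (π x)) p (T p).imagPart) := by
  have hcomp : ∀ {A B : CPlane → CVec}, IsTangentialField S A → IsTangentialField S B →
      ∀ L : CVec →L[ℝ] ℂ, fieldApply S A (fun q => L (B q)) p
        = L (fderiv ℝ (fun x => B (π x)) p (A p).realPart)
          + Complex.I * L (fderiv ℝ (fun x => B (π x)) p (A p).imagPart) := by
    intro A B hA hB L
    have hB' := ((h.contDiffAt_comp hB.1 hp.2).differentiableAt (by simp)).hasFDerivAt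
    refine (h.derivAlong_eq (L.contDiff.comp_contDiffOn hB.1) hp (hA.2 p hp.1)).trans ?_
    have := (L.hasFDerivAt.comp p hB').fderiv
    simp only [Function.comp_def] at this
    simp only [Function.comp_def]
    rw [this]
    rfl
  have h1 : ∀ {A B : CPlane → CVec}, IsTangentialField S A → IsTangentialField S B → ∀ j,
      fieldApply S A (fun q => (B q).1 j) p
        = (fderiv ℝ (fun x => B (π x)) p (A p).realPart).1 j
          + Complex.I * (fderiv ℝ (fun x => B (π x)) p (A p).imagPart).1 j := fun hA hB j =>
    hcomp hA hB ((ContinuousLinearMap.proj j).comp (ContinuousLinearMap.fst ℝ CPlane CPlane))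
  have h2 : ∀ {A B : CPlane → CVec}, IsTangentialField S A → IsTangentialField S B → ∀ j,
      fieldApply S A (fun q => (B q).2 j) p
        = (fderiv ℝ (fun x => B (π x)) p (A p).realPart).2 j
          + Complex.I * (fderiv ℝ (fun x => B (π x)) p (A p).imagPart).2 j := fun hA hB j =>
    hcomp hA hB ((ContinuousLinearMap.proj j).comp (ContinuousLinearMap.snd ℝ CPlane CPlane))
  ext j
  · simp [fieldBracket, h1 hX hT, h1 hT hX]
  · simp [fieldBracket, h2 hX hT, h2 hT hX]

theorem isTangentialField_fieldBracket {S : Set CPlane} (hS : IsRealHypersurface S)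
    {X T : CPlane → CVec} (hX : IsTangentialField S X) (hT : IsTangentialField S T) :
    IsTangentialField S (fieldBracket S X T) := by
  have hfst : ∀ {A : CPlane → CVec}, IsTangentialField S A → ∀ j : Fin 2,
      ContDiffOn ℝ ∞ (fun q => (A q).1 j) S := fun hA j =>
    ((ContinuousLinearMap.proj j).comp
      (ContinuousLinearMap.fst ℝ CPlane CPlane)).contDiff.comp_contDiffOn hA.1
  have hsnd : ∀ {A : CPlane → CVec}, IsTangentialField S A → ∀ j : Fin 2,
      ContDiffOn ℝ ∞ (fun q => (A q).2 j) S := fun hA j =>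
    ((ContinuousLinearMap.proj j).comp
      (ContinuousLinearMap.snd ℝ CPlane CPlane)).contDiff.comp_contDiffOn hA.1
  refine ⟨ContDiffOn.prodMk (contDiffOn_pi.2 fun j => ?_) (contDiffOn_pi.2 fun j => ?_), ?_⟩
  · exact (contDiffOn_fieldApply hS hX (hfst hT j)).sub (contDiffOn_fieldApply hS hT (hfst hX j))
  · exact (contDiffOn_fieldApply hS hX (hsnd hT j)).sub (contDiffOn_fieldApply hS hT (hsnd hX j))
  intro p hp
  obtain ⟨W, π, hpW, -, -, h⟩ := hS.exists_retraction hp Filter.univ_mem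
  obtain ⟨ρ, U, hpU, hρ⟩ := hS p hp
  -- Both iterated derivatives of the defining function vanish on `S`, hence so does the derivative
  -- of the defining function along the bracket.
  let g : CPlane → ℂ := fun q => (ρ q : ℂ)
  have hρC : ∀ q ∈ U, ContDiffAt ℝ ∞ ρ q := fun q hq =>
    hρ.smooth.contDiffAt (hρ.isOpen.mem_nhds hq)
  have hgC : ∀ q ∈ U, ContDiffAt ℝ ∞ g q := fun q hq =>
    Complex.ofRealCLM.contDiff.contDiffAt.comp q (hρC q hq)
  have hgD : ∀ q ∈ U, ∀ v, fderiv ℝ g q v = (fderiv ℝ ρ q v : ℂ) := fun q hq v => by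
    have := Complex.ofRealCLM.hasFDerivAt.comp q
      ((hρC q hq).differentiableAt (by simp)).hasFDerivAt
    exact congrArg (fun M => M v) this.fderiv
  have hzero : ∀ {A B : CPlane → CVec}, IsTangentialField S A → IsTangentialField S B →
      complexify (fderiv ℝ (fun q => complexify (fderiv ℝ g q) (B (π q))) p) (A p) = 0 := by
    intro A B hA hB
    have hF : ContDiffOn ℝ ∞ (fun q => complexify (fderiv ℝ g q) (B (π q))) (U ∩ W) :=
      contDiffOn_complexify (ContDiffOn.fderiv_of_isOpen
        (fun q hq => (hgC q hq.1).contDiffWithinAt) (hρ.isOpen.inter h.isOpen) (by simp))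
        ((h.contDiffOn_comp hB.1).mono Set.inter_subset_right)
    have hF' := (((hF.contDiffAt ((hρ.isOpen.inter h.isOpen).mem_nhds
      ⟨hpU, hpW⟩)).differentiableAt (by simp)).hasFDerivAt).hasFDerivWithinAt (s := S)
    have h0 : HasFDerivWithinAt (fun _ => (0 : ℂ)) _ S p := hF'.congr_of_eventuallyEq
      (by
        filter_upwards [self_mem_nhdsWithin, mem_nhdsWithin_of_mem_nhds
          ((hρ.isOpen.inter h.isOpen).mem_nhds ⟨hpU, hpW⟩)] with q hqS hq
        rw [h.eq_self q ⟨hqS, hq.2⟩, complexify, hgD q hq.1, hgD q hq.1,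
          (hB.2 q hqS).1 ρ (hρ.at hq.1), (hB.2 q hqS).2 ρ (hρ.at hq.1)]
        simp)
      (by
        rw [h.eq_self p ⟨hp, hpW⟩, complexify, hgD p hpU, hgD p hpU,
          (hB.2 p hp).1 ρ (hρ.at hpU), (hB.2 p hp).2 ρ (hρ.at hpU)]
        simp)
    rw [← derivAlong_eq hS hp h0 (hA.2 p hp), derivAlong_const hS hp 0 (hA.2 p hp)]
  have hcomm := complexify_commutator (hgC p hpU)
    ((h.contDiffAt_comp hX.1 hpW).differentiableAt (by simp))
    ((h.contDiffAt_comp hT.1 hpW).differentiableAt (by simp))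
  have hz1 := hzero hX hT
  have hz2 := hzero hT hX
  simp only [h.eq_self p ⟨hp, hpW⟩] at hcomm
  rw [hz1, hz2, ← h.fieldBracket_eq hX hT ⟨hp, hpW⟩, complexify, hgD p hpU, hgD p hpU] at hcomm
  have hre := congrArg Complex.re hcomm
  have him := congrArg Complex.im hcomm
  simp at hre him
  exact ⟨((hρ.at hpU).mem_realTangentSpace_iff hp).2 hre.symm,
    ((hρ.at hpU).mem_realTangentSpace_iff hp).2 him.symm⟩

theorem fieldApply_fieldBracket {S : Set CPlane} (hS : IsRealHypersurface S)
    {X T : CPlane → CVec} (hX : IsTangentialField S X) (hT : IsTangentialField S T)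
    {u : CPlane → ℂ} (hu : ContDiffOn ℝ ∞ u S) {p : CPlane} (hp : p ∈ S) :
    fieldApply S (fieldBracket S X T) u p
      = fieldApply S X (fieldApply S T u) p - fieldApply S T (fieldApply S X u) p := by
  obtain ⟨W, π, hpW, -, -, h⟩ := hS.exists_retraction hp Filter.univ_mem
  have hcomm := complexify_commutator (h.contDiffAt_comp hu hpW)
    ((h.contDiffAt_comp hX.1 hpW).differentiableAt (by simp))
    ((h.contDiffAt_comp hT.1 hpW).differentiableAt (by simp))
  have hval : ∀ {A B : CPlane → CVec}, IsTangentialField S A → IsTangentialField S B →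
      fieldApply S A (fieldApply S B u) p = complexify (fderiv ℝ (fun q =>
        complexify (fderiv ℝ (fun x => u (π x)) q) (B (π q))) p) (A p) := by
    intro A B hA hB
    have hF : ContDiffOn ℝ ∞ (fun q => complexify (fderiv ℝ (fun x => u (π x)) q) (B (π q))) W :=
      contDiffOn_complexify ((h.contDiffOn_comp hu).fderiv_of_isOpen h.isOpen (by simp))
        (h.contDiffOn_comp hB.1)
    have hF' := (((hF.contDiffAt (h.isOpen.mem_nhds hpW)).differentiableAt
      (by simp)).hasFDerivAt).hasFDerivWithinAt (s := S)
    refine derivAlong_eq hS hp (hF'.congr_of_eventuallyEq ?_ ?_) (hA.2 p hp)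
    · filter_upwards [self_mem_nhdsWithin, mem_nhdsWithin_of_mem_nhds
          (h.isOpen.mem_nhds hpW)] with q hqS hq
      rw [fieldApply, h.derivAlong_eq hu ⟨hqS, hq⟩ (hB.2 q hqS), h.eq_self q ⟨hqS, hq⟩]
    · rw [fieldApply, h.derivAlong_eq hu ⟨hp, hpW⟩ (hB.2 p hp), h.eq_self p ⟨hp, hpW⟩]
  rw [hval hX hT, hval hT hX]
  simp only [h.eq_self p ⟨hp, hpW⟩] at hcomm
  rw [hcomm, fieldApply, h.derivAlong_eq hu ⟨hp, hpW⟩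
    ((isTangentialField_fieldBracket hS hX hT).2 p hp), h.fieldBracket_eq hX hT ⟨hp, hpW⟩]

/-! ### Closed forms on a simply connected hypersurface are exact -/

/-- Local functions on a simply connected space whose differences are locally constant can be
corrected by locally constant functions to a global one. The possible corrections form a bundle
with discrete fibre, that is, a covering space, and this has a section. -/
theorem exists_eventually_sub_eq_sub {X G : Type*} [TopologicalSpace X] [SimplyConnectedSpace X]
    [LocallyPathConnectedSpace X] [AddCommGroup G] (U : X → Set X) (hU : ∀ i, IsOpen (U i))
    (hmem : ∀ x, x ∈ U x) (F : X → X → G)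
    (hF : ∀ i j, ∀ x ∈ U i ∩ U j, ∀ᶠ y in nhds x, F i y - F j y = F i x - F j x) :
    ∃ f : X → G, ∀ i, ∀ x ∈ U i, ∀ᶠ y in nhds x, f y - F i y = f x - F i x := by
  let _ : TopologicalSpace G := ⊥
  have : DiscreteTopology G := ⟨rfl⟩
  -- The coordinate `c` over `U i` stands for the value `F i x + c`.
  let Z : FiberBundleCore X X G :=
    { baseSet := U
      isOpen_baseSet := hU
      indexAt := id
      mem_baseSet_at := hmem
      coordChange := fun i j x c => c + (F i x - F j x)
      coordChange_self := fun i x _ c => by simp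
      continuousOn_coordChange := by
        rintro i j ⟨x, c⟩ ⟨hx, -⟩
        refine ContinuousAt.continuousWithinAt ?_
        refine (tendsto_const_nhds (x := c + (F i x - F j x))).congr' ?_
        have h2 : ∀ᶠ q : X × G in nhds (x, c), q.2 = c :=
          (continuous_snd.tendsto (x, c)).eventually
            (show ∀ᶠ y in nhds c, y = c by simp [nhds_discrete])
        have h1 : ∀ᶠ q : X × G in nhds (x, c), F i q.1 - F j q.1 = F i x - F j x :=
          (continuous_fst.tendsto (x, c)).eventually (hF i j x hx)
        filter_upwards [h1, h2] with q h1 h2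
        rw [h1, h2]
      coordChange_comp := fun i j k x _ c => by abel }
  have hcov : IsCoveringMap (Bundle.TotalSpace.proj : Bundle.TotalSpace G Z.Fiber → X) :=
    FiberBundle.isCoveringMap
  obtain ⟨x0⟩ : Nonempty X := inferInstance
  obtain ⟨s, ⟨-, hs⟩, -⟩ := hcov.existsUnique_continuousMap_lifts (ContinuousMap.id X) x0
    (⟨x0, (0 : G)⟩ : Bundle.TotalSpace G Z.Fiber) rfl
  have hs1 : ∀ x, (s x).proj = x := fun x => congrFun hs x
  have hc : ∀ x, ∃ c : G, s x = ⟨x, c⟩ := fun x => by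
    have h := hs1 x
    rcases hsx : s x with ⟨y, c⟩
    rw [hsx] at h
    obtain rfl : y = x := h
    exact ⟨c, rfl⟩
  choose c hc using hc
  refine ⟨fun x => F x x + c x, fun i x hx => ?_⟩
  have hcont : ContinuousAt (fun y => (Z.localTriv i (s y)).2) x := by
    have h1 : ContinuousAt (Z.localTriv i) (s x) :=
      (Z.localTriv i).continuousAt (by
        rw [Z.mem_localTriv_source]
        show (s x).proj ∈ U i
        rwa [hs1])
    exact continuous_snd.continuousAt.comp (h1.comp s.continuous.continuousAt)
  have hev := hcont.eventually (show ∀ᶠ a in nhds ((Z.localTriv i (s x)).2),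
    a = (Z.localTriv i (s x)).2 by simp [nhds_discrete])
  filter_upwards [hev] with y hy
  have hval : ∀ y, (Z.localTriv i (s y)).2 = c y + (F y y - F i y) := fun y => by
    rw [hc y]; rfl
  rw [hval, hval] at hy
  calc F y y + c y - F i y = c y + (F y y - F i y) := by abel
    _ = c x + (F x x - F i x) := hy
    _ = _ := by abel

theorem IsRealHypersurface.locallyPathConnectedSpace {S : Set CPlane} (hS : IsRealHypersurface S) :
    LocallyPathConnectedSpace S := by
  refine ⟨fun x => Filter.hasBasis_self.2 fun t ht => ?_⟩
  obtain ⟨N, hN, hNt⟩ := mem_nhds_subtype S x t |>.1 ht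
  obtain ⟨W, π, hxW, hWN, hπN, h⟩ := hS.exists_retraction x.2 hN
  have : PathConnectedSpace W := isPathConnected_iff_pathConnectedSpace.1
    (h.convex.isPathConnected ⟨_, hxW⟩)
  have hc : Continuous (fun w : W => (⟨π w, h.mapsTo w.2⟩ : S)) :=
    (continuousOn_iff_continuous_domRestrict.1 h.smooth.continuousOn).subtype_mk _
  refine ⟨Set.range (fun w : W => (⟨π w, h.mapsTo w.2⟩ : S)), ?_, isPathConnected_range hc, ?_⟩
  · filter_upwards [continuous_subtype_val.continuousAt.preimage_mem_nhds
      (h.isOpen.mem_nhds hxW)] with y hy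
    exact ⟨⟨y, hy⟩, Subtype.ext (h.eq_self y ⟨y.2, hy⟩)⟩
  · rintro _ ⟨w, rfl⟩
    exact hNt (hπN w.2)

theorem IsLocalRetraction.fderiv_comp {S W : Set CPlane} {π : CPlane → CPlane}
    (h : IsLocalRetraction S W π) {u : CPlane → ℂ} (hu : ContDiffOn ℝ ∞ u S) {y : CPlane}
    (hy : y ∈ W) (v : CPlane) :
    fderiv ℝ (fun x => u (π x)) y v = fderivWithin ℝ u S (π y) (fderiv ℝ π y v) := by
  have hπ := (h.smooth.contDiffAt (h.isOpen.mem_nhds hy))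
  have h1 : HasFDerivWithinAt π (fderiv ℝ π y) W y :=
    (hπ.differentiableAt (by simp)).hasFDerivAt.hasFDerivWithinAt
  have h2 := ((hu.differentiableOn (by simp)) (π y) (h.mapsTo hy)).hasFDerivWithinAt
  have h3 := (h2.comp y h1 h.mapsTo).hasFDerivAt (h.isOpen.mem_nhds hy)
  exact congrArg (fun A => A v) h3.fderiv

/-- The Poincaré lemma on a hypersurface: the form `∑ j, a j dz_j` is closed on `S` if its
exterior derivative `∑ j, da_j ∧ dz_j` vanishes on tangent vectors. -/
theorem IsLocalRetraction.exists_primitive {S W : Set CPlane} {π : CPlane → CPlane}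
    (h : IsLocalRetraction S W π) {a : Fin 2 → CPlane → ℂ} (ha : ∀ j, ContDiffOn ℝ ∞ (a j) S)
    (hclosed : ∀ p ∈ S, ∀ v ∈ realTangentSpace S p, ∀ w ∈ realTangentSpace S p,
      ∑ j, fderivWithin ℝ (a j) S p v * w j = ∑ j, fderivWithin ℝ (a j) S p w * v j) :
    ∃ F : CPlane → ℂ, ContDiffOn ℝ ∞ F W ∧
      ∀ q ∈ S ∩ W, ∀ v ∈ realTangentSpace S q, fderiv ℝ F q v = ∑ j, a j q * v j := by
  let z : Fin 2 → CPlane → ℂ := fun j x => π x j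
  let α : Fin 2 → CPlane → ℂ := fun j x => a j (π x)
  let η : CPlane → CPlane →L[ℝ] ℂ := fun y => ∑ j, α j y • fderiv ℝ (z j) y
  have hz : ∀ j, ContDiffOn ℝ ∞ (z j) W := fun j =>
    (ContinuousLinearMap.proj (R := ℝ) (φ := fun _ : Fin 2 => ℂ) j).contDiff.comp_contDiffOn
      h.smooth
  have hzD : ∀ j, ∀ y ∈ W, ∀ v, fderiv ℝ (z j) y v = fderiv ℝ π y v j := fun j y hy v => by
    have hπ := ((h.smooth.contDiffAt (h.isOpen.mem_nhds hy)).differentiableAt (by simp)).hasFDerivAt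
    have := ((ContinuousLinearMap.proj (R := ℝ) (φ := fun _ : Fin 2 => ℂ) j).hasFDerivAt.comp y
      hπ).fderiv
    exact congrArg (fun A => A v) this
  have hα : ∀ j, ContDiffOn ℝ ∞ (α j) W := fun j => h.contDiffOn_comp (ha j)
  have hzF : ∀ j, ContDiffOn ℝ ∞ (fderiv ℝ (z j)) W := fun j =>
    (hz j).fderiv_of_isOpen h.isOpen (by simp)
  have hη : ContDiffOn ℝ ∞ η W := ContDiffOn.sum fun j _ => (hα j).smul (hzF j)
  have hηD : ∀ y ∈ W, ∀ v w, fderiv ℝ η y v w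
      = ∑ j, (α j y * fderiv ℝ (fderiv ℝ (z j)) y v w
        + fderivWithin ℝ (a j) S (π y) (fderiv ℝ π y v) * fderiv ℝ π y w j) := by
    intro y hy v w
    have hW := h.isOpen.mem_nhds hy
    have h1 : HasFDerivAt η _ y := HasFDerivAt.fun_sum fun j (_ : j ∈ Finset.univ) =>
      ((((hα j).contDiffAt hW).differentiableAt (by simp)).hasFDerivAt).smul
        ((((hzF j).contDiffAt hW).differentiableAt (by simp)).hasFDerivAt)
    rw [h1.fderiv]
    simp only [sum_apply, add_apply, smul_apply, smul_eq_mul,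
      ContinuousLinearMap.smulRight_apply]
    refine Finset.sum_congr rfl fun j _ => ?_
    rw [← hzD j y hy w, ← h.fderiv_comp (ha j) hy v]
  obtain ⟨F, hF⟩ := h.convex.exists_forall_hasFDerivAt_of_fderiv_symmetric h.isOpen
    (hη.differentiableOn (by simp)) (by
      intro y hy v w
      have hsymm : ∀ j, fderiv ℝ (fderiv ℝ (z j)) y v w = fderiv ℝ (fderiv ℝ (z j)) y w v :=
        fun j => (((hz j).contDiffAt (h.isOpen.mem_nhds hy)).isSymmSndFDerivAt (by
          rw [minSmoothness_of_isRCLikeNormedField]; exact WithTop.coe_le_coe.2 le_top)).eq v w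
      rw [hηD y hy, hηD y hy, Finset.sum_add_distrib, Finset.sum_add_distrib,
        hclosed (π y) (h.mapsTo hy) _ (h.mem_realTangentSpace hy v) _
          (h.mem_realTangentSpace hy w)]
      simp only [hsymm])
  refine ⟨F, ?_, ?_⟩
  · refine (contDiffOn_infty_iff_fderiv_of_isOpen h.isOpen).2
      ⟨fun y hy => (hF y hy).differentiableAt.differentiableWithinAt, ?_⟩
    exact hη.congr fun y hy => (hF y hy).fderiv
  · intro q hq v hv
    rw [(hF q hq.2).fderiv]
    simp only [η, sum_apply, smul_apply, smul_eq_mul, hzD _ q hq.2,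
      h.fderiv_apply q hq v hv, α, h.eq_self q hq]

/-- A function whose derivative vanishes on tangent vectors is locally constant on `S`. -/
theorem IsRealHypersurface.eventually_eq_of_fderiv_eq_zero {S : Set CPlane}
    (hS : IsRealHypersurface S) {G : CPlane → ℂ} {N : Set CPlane} (hN : IsOpen N)
    (hG : ContDiffOn ℝ ∞ G N)
    (h0 : ∀ q ∈ S ∩ N, ∀ v ∈ realTangentSpace S q, fderiv ℝ G q v = 0) {p : CPlane}
    (hp : p ∈ S ∩ N) : ∀ᶠ q in nhdsWithin p S, G q = G p := by
  obtain ⟨W, π, hpW, -, hπN, h⟩ := hS.exists_retraction hp.1 (hN.mem_nhds hp.2)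
  have hD : ∀ y ∈ W, HasFDerivAt (fun x => G (π x)) (0 : CPlane →L[ℝ] ℂ) y := fun y hy => by
    have hπ := ((h.smooth.contDiffAt (h.isOpen.mem_nhds hy)).differentiableAt (by simp)).hasFDerivAt
    have hG' := ((hG.contDiffAt (hN.mem_nhds (hπN hy))).differentiableAt (by simp)).hasFDerivAt
    have hcomp : (fderiv ℝ G (π y)).comp (fderiv ℝ π y) = 0 := by
      ext v
      exact h0 _ ⟨h.mapsTo hy, hπN hy⟩ _ (h.mem_realTangentSpace hy v)
    exact hcomp ▸ hG'.comp y hπ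
  filter_upwards [self_mem_nhdsWithin, mem_nhdsWithin_of_mem_nhds (h.isOpen.mem_nhds hpW)]
    with q hqS hq
  have := h.isOpen.is_const_of_fderiv_eq_zero (𝕜 := ℝ) h.convex.isPreconnected
    (fun y hy => (hD y hy).differentiableAt.differentiableWithinAt)
    (fun y hy => (hD y hy).fderiv) hq hpW
  simpa [h.eq_self q ⟨hqS, hq⟩, h.eq_self p ⟨hp.1, hpW⟩] using this

/-- A closed form `∑ j, a j dz_j` on a simply connected hypersurface is exact. -/
theorem IsRealHypersurface.exists_primitive {S : Set CPlane} (hS : IsRealHypersurface S)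
    (hsc : SimplyConnectedSpace S) {a : Fin 2 → CPlane → ℂ} (ha : ∀ j, ContDiffOn ℝ ∞ (a j) S)
    (hclosed : ∀ p ∈ S, ∀ v ∈ realTangentSpace S p, ∀ w ∈ realTangentSpace S p,
      ∑ j, fderivWithin ℝ (a j) S p v * w j = ∑ j, fderivWithin ℝ (a j) S p w * v j) :
    ∃ f : CPlane → ℂ, ContDiffOn ℝ ∞ f S ∧ ∀ p ∈ S, ∀ V ∈ complexifiedTangentSpace S p,
      derivAlong S f p V = ∑ j, a j p * V.1 j := by
  classical
  have := hS.locallyPathConnectedSpace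
  have hloc : ∀ p : S, ∃ (W : Set CPlane) (F : CPlane → ℂ), IsOpen W ∧ (p : CPlane) ∈ W ∧
      ContDiffOn ℝ ∞ F W ∧
      ∀ q ∈ S ∩ W, ∀ v ∈ realTangentSpace S q, fderiv ℝ F q v = ∑ j, a j q * v j := by
    intro p
    obtain ⟨W, π, hpW, -, -, h⟩ := hS.exists_retraction p.2 Filter.univ_mem
    obtain ⟨F, hF, hF'⟩ := h.exists_primitive ha hclosed
    exact ⟨W, F, h.isOpen, hpW, hF, hF'⟩
  choose W F hW hmem hF hFD using hloc
  obtain ⟨f, hf⟩ := exists_eventually_sub_eq_sub (X := S) (fun p => Subtype.val ⁻¹' W p)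
    (fun p => (hW p).preimage continuous_subtype_val) hmem (fun p q => F p q) (by
      rintro i j x ⟨hi, hj⟩
      have hd : ∀ {k : S} {q : CPlane}, q ∈ W k → DifferentiableAt ℝ (F k) q := fun {k q} hq =>
        ((hF k).contDiffAt ((hW k).mem_nhds hq)).differentiableAt (by simp)
      have := hS.eventually_eq_of_fderiv_eq_zero (G := fun q => F i q - F j q)
        ((hW i).inter (hW j)) (((hF i).mono Set.inter_subset_left).sub
          ((hF j).mono Set.inter_subset_right)) (by
          rintro q ⟨hqS, hqi, hqj⟩ v hv
          rw [fderiv_fun_sub (hd hqi) (hd hqj), sub_apply, hFD i q ⟨hqS, hqi⟩ v hv,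
            hFD j q ⟨hqS, hqj⟩ v hv, sub_self]) (p := x) ⟨x.2, hi, hj⟩
      rwa [← map_nhds_subtype_val, Filter.eventually_map] at this)
  let g : CPlane → ℂ := fun q => if h : q ∈ S then f ⟨q, h⟩ else 0
  have hg : ∀ q : S, g q = f q := fun q => by simp [g]
  have hev : ∀ p (hp : p ∈ S), ∀ᶠ q in nhdsWithin p S,
      g q = F ⟨p, hp⟩ q + (g p - F ⟨p, hp⟩ p) := by
    intro p hp
    have := hf ⟨p, hp⟩ ⟨p, hp⟩ (hmem _)
    rw [← map_nhds_subtype_val (s := S) ⟨p, hp⟩, Filter.eventually_map]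
    filter_upwards [this] with q hq
    rw [hg q, show g p = f ⟨p, hp⟩ from hg ⟨p, hp⟩]
    linear_combination hq
  refine ⟨g, fun p hp => ?_, fun p hp V hV => ?_⟩
  · exact ((((hF ⟨p, hp⟩).contDiffAt ((hW _).mem_nhds (hmem _))).add
      contDiffAt_const).contDiffWithinAt (s := S)).congr_of_eventuallyEq (hev p hp) (by ring)
  · have hD := ((((hF ⟨p, hp⟩).contDiffAt ((hW _).mem_nhds (hmem _))).differentiableAt
      (by simp)).hasFDerivAt.add_const (g p - F ⟨p, hp⟩ p)).hasFDerivWithinAt (s := S)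
    rw [derivAlong_eq hS hp (hD.congr_of_eventuallyEq (hev p hp) (by ring)) hV, complexify,
      hFD ⟨p, hp⟩ p ⟨hp, hmem _⟩ _ hV.1, hFD ⟨p, hp⟩ p ⟨hp, hmem _⟩ _ hV.2,
      ← V.realPart_add_I_smul_imagPart, Finset.mul_sum, ← Finset.sum_add_distrib]
    refine Finset.sum_congr rfl fun j _ => ?_
    simp only [Pi.add_apply, Pi.smul_apply, smul_eq_mul]
    ring

/-! ### The dual coordinates -/

theorem CPlane.eq_sum_single (v : CPlane) : v = ∑ j, ((v j).re • (Pi.single j 1 : CPlane)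
    + (v j).im • (Pi.single j Complex.I : CPlane)) := by
  ext j
  fin_cases j <;> simp [Fin.sum_univ_two]

theorem sum_mul_wirtingerDeriv (ρ : CPlane → ℝ) (p v : CPlane) :
    ∑ j, v j * wirtingerDeriv ρ j p
      = ((fderiv ℝ ρ p v : ℂ) - Complex.I * (fderiv ℝ ρ p (Complex.I • v) : ℝ)) / 2 := by
  have h1 := congrArg (fderiv ℝ ρ p) (CPlane.eq_sum_single v)
  have h2 := congrArg (fderiv ℝ ρ p) (CPlane.eq_sum_single (Complex.I • v))
  rw [h1, h2]
  simp only [Fin.sum_univ_two, map_add, map_smul, Pi.smul_apply, smul_eq_mul, Complex.I_mul_re,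
    Complex.I_mul_im, wirtingerDeriv, Complex.ofReal_add, Complex.ofReal_mul, Complex.ofReal_neg]
  conv_lhs => rw [← Complex.re_add_im (v 0), ← Complex.re_add_im (v 1)]
  ring_nf
  rw [Complex.I_sq]
  ring

theorem IsDefiningFunctionAt.fderiv_ne_zero {S : Set CPlane} {p : CPlane} (hp : p ∈ S)
    {ρ : CPlane → ℝ} (hρ : IsDefiningFunctionAt S p ρ) : fderiv ℝ ρ p ≠ 0 := by
  obtain ⟨U, hpU, hρ⟩ := hρ
  exact hρ.fderiv_ne_zero p ⟨hp, hpU⟩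

theorem IsDefiningFunctionAt.exists_fderiv_eq_one {S : Set CPlane} {p : CPlane} (hp : p ∈ S)
    {ρ : CPlane → ℝ} (hρ : IsDefiningFunctionAt S p ρ) : ∃ v, fderiv ℝ ρ p v = 1 := by
  obtain ⟨v, hv⟩ : ∃ v, fderiv ℝ ρ p v ≠ 0 := by
    by_contra! hc
    exact hρ.fderiv_ne_zero hp (by ext v; simpa using hc v)
  exact ⟨(fderiv ℝ ρ p v)⁻¹ • v, by simp [hv]⟩

theorem IsDefiningFunctionAt.exists_fderiv_eq_smul {S : Set CPlane} {p : CPlane} (hp : p ∈ S)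
    {ρ ρ' : CPlane → ℝ} (hρ : IsDefiningFunctionAt S p ρ) (hρ' : IsDefiningFunctionAt S p ρ') :
    ∃ c : ℝ, c ≠ 0 ∧ fderiv ℝ ρ' p = c • fderiv ℝ ρ p := by
  obtain ⟨v0, hv0⟩ := hρ.exists_fderiv_eq_one hp
  have h : fderiv ℝ ρ' p = fderiv ℝ ρ' p v0 • fderiv ℝ ρ p := by
    ext v
    have hv : v - fderiv ℝ ρ p v • v0 ∈ realTangentSpace S p :=
      (hρ.mem_realTangentSpace_iff hp).2 (by simp [hv0])
    have := hv ρ' hρ'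
    rw [map_sub, map_smul, smul_eq_mul] at this
    rw [smul_apply, smul_eq_mul]
    linarith
  refine ⟨_, fun h0 => hρ'.fderiv_ne_zero hp ?_, h⟩
  rw [h, h0, zero_smul]

theorem dualCoord_eq {S : Set CPlane} {p : CPlane} (hp : p ∈ S)
    {ρ : CPlane → ℝ} (hρ : IsDefiningFunctionAt S p ρ) (j : Fin 2) :
    dualCoord S j p = wirtingerDeriv ρ j p / ∑ k, p k * wirtingerDeriv ρ k p := by
  have hex : ∃ ρ : CPlane → ℝ, IsDefiningFunctionAt S p ρ := ⟨ρ, hρ⟩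
  obtain ⟨c, hc, h⟩ := hρ.exists_fderiv_eq_smul hp hex.choose_spec
  have hw : ∀ k, wirtingerDeriv hex.choose k p = c * wirtingerDeriv ρ k p := fun k => by
    simp only [wirtingerDeriv, h, smul_apply, smul_eq_mul, Complex.ofReal_mul]
    ring
  have hc' : (c : ℂ) ≠ 0 := by exact_mod_cast hc
  rw [dualCoord, dif_pos hex]
  simp only [hw, mul_left_comm _ (c : ℂ), ← Finset.mul_sum]
  rw [mul_div_mul_left _ _ hc']

theorem sum_mul_wirtingerDeriv_ne_zero {S : Set CPlane} (h0 : NoComplexTangentLineThroughZero S)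
    {p : CPlane} (hp : p ∈ S) {ρ : CPlane → ℝ} (hρ : IsDefiningFunctionAt S p ρ) :
    ∑ k, p k * wirtingerDeriv ρ k p ≠ 0 := by
  rw [sum_mul_wirtingerDeriv]
  intro h
  have hre := congrArg Complex.re h
  have him := congrArg Complex.im h
  simp at hre him
  refine h0 p hp ⟨-p, ⟨?_, Complex.I • p, ?_, ?_⟩, by simp⟩
  · exact neg_mem ((hρ.mem_realTangentSpace_iff hp).2 hre)
  · exact (hρ.mem_realTangentSpace_iff hp).2 him
  · rw [smul_smul, Complex.I_mul_I, neg_one_smul]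

theorem mul_dualCoord_sum {S : Set CPlane} (hS : IsRealHypersurface S)
    (h0 : NoComplexTangentLineThroughZero S) {p : CPlane} (hp : p ∈ S) :
    p 0 * dualCoord S 0 p + p 1 * dualCoord S 1 p = 1 := by
  obtain ⟨ρ, hρ⟩ := hS p hp
  have h := sum_mul_wirtingerDeriv_ne_zero h0 hp hρ
  rw [dualCoord_eq hp hρ, dualCoord_eq hp hρ]
  rw [Fin.sum_univ_two] at h ⊢
  field_simp

/-- The vectors annihilated by `∑ j, w_j dz_j` make up the maximal complex subspace. -/
theorem dualCoord_annihilates_iff {S : Set CPlane} (hS : IsRealHypersurface S)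
    (h0 : NoComplexTangentLineThroughZero S) {p : CPlane} (hp : p ∈ S) (v : CPlane) :
    v 0 * dualCoord S 0 p + v 1 * dualCoord S 1 p = 0 ↔
      v ∈ realTangentSpace S p ∧ Complex.I • v ∈ realTangentSpace S p := by
  obtain ⟨ρ, hρ⟩ := hS p hp
  have h := sum_mul_wirtingerDeriv_ne_zero h0 hp hρ
  have h1 : v 0 * dualCoord S 0 p + v 1 * dualCoord S 1 p
      = (∑ j, v j * wirtingerDeriv ρ j p) / ∑ k, p k * wirtingerDeriv ρ k p := by
    rw [dualCoord_eq hp hρ, dualCoord_eq hp hρ, Fin.sum_univ_two, Fin.sum_univ_two]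
    ring
  rw [h1, div_eq_zero_iff, or_iff_left h, sum_mul_wirtingerDeriv,
    hρ.mem_realTangentSpace_iff hp, hρ.mem_realTangentSpace_iff hp]
  refine ⟨fun h => ?_, fun ⟨h1, h2⟩ => by simp [h1, h2]⟩
  have hre := congrArg Complex.re h
  have him := congrArg Complex.im h
  simp at hre him
  exact ⟨hre, him⟩

theorem IsDefiningFunctionOn.contDiffOn_wirtingerDeriv {S U : Set CPlane} {ρ : CPlane → ℝ}
    (hρ : IsDefiningFunctionOn S U ρ) (j : Fin 2) : ContDiffOn ℝ ∞ (wirtingerDeriv ρ j) U := by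
  have h : ∀ v, ContDiffOn ℝ ∞ (fun q => ((fderiv ℝ ρ q v : ℝ) : ℂ)) U := fun v =>
    Complex.ofRealCLM.contDiff.comp_contDiffOn
      ((hρ.smooth.fderiv_of_isOpen hρ.isOpen (by simp)).clm_apply contDiffOn_const)
  exact ((h _).sub (contDiffOn_const.mul (h _))).div_const 2

theorem IsDefiningFunctionOn.contDiffOn_sum_mul_wirtingerDeriv {S U : Set CPlane}
    {ρ : CPlane → ℝ} (hρ : IsDefiningFunctionOn S U ρ) :
    ContDiffOn ℝ ∞ (fun q => ∑ k, q k * wirtingerDeriv ρ k q) U :=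
  ContDiffOn.sum fun k _ => ContDiffOn.mul (contDiff_apply ℝ ℂ k).contDiffOn
    (hρ.contDiffOn_wirtingerDeriv k)

theorem contDiffOn_dualCoord {S : Set CPlane} (hS : IsRealHypersurface S)
    (h0 : NoComplexTangentLineThroughZero S) (j : Fin 2) : ContDiffOn ℝ ∞ (dualCoord S j) S := by
  intro p hp
  obtain ⟨ρ, U, hpU, hρ⟩ := hS p hp
  have h : ContDiffOn ℝ ∞ (dualCoord S j) (S ∩ U) := by
    refine (((hρ.contDiffOn_wirtingerDeriv j).mono Set.inter_subset_right).mul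
      ((hρ.contDiffOn_sum_mul_wirtingerDeriv.mono Set.inter_subset_right).inv fun q hq =>
        sum_mul_wirtingerDeriv_ne_zero h0 hq.1 (hρ.at hq.2))).congr fun q hq => ?_
    rw [dualCoord_eq hq.1 (hρ.at hq.2) j, div_eq_mul_inv, Pi.inv_apply]
  exact (h p ⟨hp, hpU⟩).mono_of_mem_nhdsWithin (inter_mem_nhdsWithin S (hρ.isOpen.mem_nhds hpU))

/-- The derivatives of the dual coordinates are given by the Hessian of a defining function. -/
theorem sum_fderivWithin_dualCoord_mul {S : Set CPlane} (hS : IsRealHypersurface S)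
    (h0 : NoComplexTangentLineThroughZero S) {p : CPlane} (hp : p ∈ S) {ρ : CPlane → ℝ}
    (hρ : IsDefiningFunctionAt S p ρ) {v t : CPlane} (hv : v ∈ realTangentSpace S p)
    (ht : t 0 * dualCoord S 0 p + t 1 * dualCoord S 1 p = 0) :
    (∑ k, p k * wirtingerDeriv ρ k p) *
      (t 0 * fderivWithin ℝ (dualCoord S 0) S p v + t 1 * fderivWithin ℝ (dualCoord S 1) S p v)
    = ((fderiv ℝ (fderiv ℝ ρ) p v t : ℂ)
      - Complex.I * (fderiv ℝ (fderiv ℝ ρ) p v (Complex.I • t) : ℝ)) / 2 := by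
  have hD0 := sum_mul_wirtingerDeriv_ne_zero h0 hp hρ
  obtain ⟨U, hpU, hρ⟩ := hρ
  have hU := hρ.isOpen.mem_nhds hpU
  set D : CPlane → ℂ := fun q => ∑ k, q k * wirtingerDeriv ρ k q with hD
  have hDC : ContDiffAt ℝ ∞ D p := hρ.contDiffOn_sum_mul_wirtingerDeriv.contDiffAt hU
  have hWC : ∀ j, ContDiffAt ℝ ∞ (fun q => wirtingerDeriv ρ j q / D q) p := fun j => by
    simp only [div_eq_mul_inv]
    exact ((hρ.contDiffOn_wirtingerDeriv j).contDiffAt hU).mul (hDC.inv hD0)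
  have hW : ∀ j, HasFDerivAt (fun q => wirtingerDeriv ρ j q / D q)
      (fderiv ℝ (fun q => wirtingerDeriv ρ j q / D q) p) p := fun j =>
    ((hWC j).differentiableAt (by simp)).hasFDerivAt
  have hw : ∀ j, fderivWithin ℝ (dualCoord S j) S p v
      = fderiv ℝ (fun q => wirtingerDeriv ρ j q / D q) p v := fun j => by
    refine hS.fderivWithin_apply hp ((hW j).hasFDerivWithinAt.congr_of_eventuallyEq ?_ ?_) hv
    · filter_upwards [self_mem_nhdsWithin, mem_nhdsWithin_of_mem_nhds hU] with q hqS hq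
      exact dualCoord_eq hqS (hρ.at hq) j
    · exact dualCoord_eq hp (hρ.at hpU) j
  -- The identity to differentiate is `D * ∑ j, t_j w_j = ∑ j, t_j ∂ρ/∂z_j`.
  have hDd := (hDC.differentiableAt (by simp)).hasFDerivAt
  have hL := (hDd.mul (((hW 0).const_mul (t 0)).add ((hW 1).const_mul (t 1))))
  have hD2 : HasFDerivAt (fderiv ℝ ρ) (fderiv ℝ (fderiv ℝ ρ) p) p :=
    (((hρ.smooth.fderiv_of_isOpen hρ.isOpen (m := ∞) (by simp)).contDiffAt hU).differentiableAt
      (by simp)).hasFDerivAt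
  have hR1 : ∀ s, HasFDerivAt (fun q => ((fderiv ℝ ρ q s : ℝ) : ℂ)) _ p := fun s =>
    Complex.ofRealCLM.hasFDerivAt.comp p (hD2.clm_apply (hasFDerivAt_const s p))
  have hR := ((hR1 t).sub ((hR1 (Complex.I • t)).const_mul Complex.I)).mul_const (2 : ℂ)⁻¹
  have hR' : HasFDerivAt (fun q =>
      D q * (t 0 * (wirtingerDeriv ρ 0 q / D q) + t 1 * (wirtingerDeriv ρ 1 q / D q))) _ p :=
    hR.congr_of_eventuallyEq (by
      filter_upwards [hDC.continuousAt.eventually_ne hD0] with q hq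
      have h := sum_mul_wirtingerDeriv ρ q t
      rw [Fin.sum_univ_two] at h
      rw [← div_eq_mul_inv, Pi.sub_apply, ← h]
      field_simp)
  have key := congrArg (fun M => M v) (hL.unique hR')
  have hd : ∀ j, wirtingerDeriv ρ j p / D p = dualCoord S j p :=
    fun j => (dualCoord_eq hp (hρ.at hpU) j).symm
  simp only [add_apply, smul_apply, smul_eq_mul, ← hw, Pi.add_apply, sub_apply, hd, ht] at key
  simp at key
  linear_combination key

/-! ### Nondegeneracy from strong `ℂ`-convexity -/

theorem IsRealHypersurface.fderiv_apply_eq_zero {S : Set CPlane} (hS : IsRealHypersurface S)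
    {p : CPlane} (hp : p ∈ S) {G : CPlane → ℝ} (hG : DifferentiableAt ℝ G p)
    (h0 : ∀ᶠ q in nhdsWithin p S, G q = 0) {v : CPlane} (hv : v ∈ realTangentSpace S p) :
    fderiv ℝ G p v = 0 := by
  have h1 : HasFDerivWithinAt (fun _ : CPlane => (0 : ℝ)) (fderiv ℝ G p) S p :=
    hG.hasFDerivAt.hasFDerivWithinAt.congr_of_eventuallyEq
      (by filter_upwards [h0] with q hq using hq.symm)
      (h0.self_of_nhdsWithin hp).symm
  rw [← hS.fderivWithin_apply hp h1 hv,
    hS.fderivWithin_apply hp (hasFDerivWithinAt_const (0 : ℝ) p S) hv]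
  rfl

/-- The second derivative of a function along a curve. -/
theorem deriv_deriv_comp_curve {ρ : CPlane → ℝ} {γ γ' : ℝ → CPlane} {γ'' : CPlane}
    (hρ : ∀ᶠ q in nhds (γ 0), DifferentiableAt ℝ ρ q)
    (hρ' : DifferentiableAt ℝ (fderiv ℝ ρ) (γ 0))
    (hγ : ∀ᶠ t in nhds 0, HasDerivAt γ (γ' t) t) (hγ' : HasDerivAt γ' γ'' 0) :
    deriv (deriv fun t => ρ (γ t)) 0
      = fderiv ℝ (fderiv ℝ ρ) (γ 0) (γ' 0) (γ' 0) + fderiv ℝ ρ (γ 0) γ'' := by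
  have hγ0 := hγ.self_of_nhds
  have h1 : deriv (fun t => ρ (γ t)) =ᶠ[nhds 0] fun t => fderiv ℝ ρ (γ t) (γ' t) := by
    filter_upwards [hγ, hγ0.continuousAt.eventually hρ] with t ht ht'
    exact (ht'.hasFDerivAt.comp_hasDerivAt t ht).deriv
  rw [h1.deriv_eq]
  have h2 := hρ'.hasFDerivAt.comp_hasDerivAt (0 : ℝ) hγ0
  exact (h2.clm_apply hγ').deriv

theorem projectiveImage_add_smul (M : GL (Fin 3) ℂ) (p v : CPlane) (s : ℂ) (i : Fin 3) :
    projectiveImage M (p + s • v) i = projectiveImage M p i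
      + s * Matrix.mulVec (M : Matrix (Fin 3) (Fin 3) ℂ) (Matrix.vecCons 0 v) i := by
  have h : Matrix.vecCons 1 (p + s • v)
      = Matrix.vecCons 1 p + s • (Matrix.vecCons 0 v : Fin 3 → ℂ) := by
    ext k
    refine Fin.cases ?_ (fun k => ?_) k <;> simp
  simp only [projectiveImage]
  rw [h, Matrix.mulVec_add, Matrix.mulVec_smul]
  simp

/-- The direction of the image under a projective map of the complex line through `p` in the
direction `v`. -/
noncomputable def projectiveDirection (M : GL (Fin 3) ℂ) (p v : CPlane) : CPlane := fun j =>
  Matrix.mulVec (M : Matrix (Fin 3) (Fin 3) ℂ) (Matrix.vecCons 0 v) j.succ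
    - Matrix.mulVec (M : Matrix (Fin 3) (Fin 3) ℂ) (Matrix.vecCons 0 v) 0
      * projectiveImage M p j.succ / projectiveImage M p 0

theorem projectiveDirection_ne_zero {M : GL (Fin 3) ℂ} {p v : CPlane}
    (hp : projectiveImage M p 0 ≠ 0) (hv : v ≠ 0) : projectiveDirection M p v ≠ 0 := by
  intro h
  set c := Matrix.mulVec (M : Matrix (Fin 3) (Fin 3) ℂ) (Matrix.vecCons 0 v) 0
    / projectiveImage M p 0 with hc
  have h1 : Matrix.mulVec (M : Matrix (Fin 3) (Fin 3) ℂ) (Matrix.vecCons 0 v)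
      = Matrix.mulVec (M : Matrix (Fin 3) (Fin 3) ℂ) (c • Matrix.vecCons 1 p) := by
    rw [Matrix.mulVec_smul]
    ext k
    refine Fin.cases ?_ (fun k => ?_) k
    · rw [Pi.smul_apply, smul_eq_mul]
      exact (div_mul_cancel₀ _ hp).symm
    · have := congrFun h k
      simp only [projectiveDirection, Pi.zero_apply, sub_eq_zero] at this
      rw [this, Pi.smul_apply, smul_eq_mul, hc, projectiveImage]
      ring
  have h2 := Matrix.mulVec_injective_of_isUnit M.isUnit h1
  have h3 : c = 0 := by simpa using (congrFun h2 0).symm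
  apply hv
  ext k
  simpa [h3] using congrFun h2 k.succ

/-- A projective map sends the line `p + s v` to the line through the image of `p`, with the
parameter changed to `s / (λ + s μ)`. -/
theorem projectiveMap_add_smul {M : GL (Fin 3) ℂ} {p v : CPlane} {s : ℂ}
    (hp : projectiveImage M p 0 ≠ 0) (hs : projectiveImage M (p + s • v) 0 ≠ 0) :
    projectiveMap M (p + s • v) = projectiveMap M p
      + (s / (projectiveImage M p 0
        + s * Matrix.mulVec (M : Matrix (Fin 3) (Fin 3) ℂ) (Matrix.vecCons 0 v) 0))
        • projectiveDirection M p v := by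
  ext j
  simp only [projectiveMap, projectiveDirection, Pi.add_apply, Pi.smul_apply, smul_eq_mul]
  rw [projectiveImage_add_smul] at hs
  rw [projectiveImage_add_smul, projectiveImage_add_smul]
  field_simp
  ring

theorem contDiff_projectiveImage (M : GL (Fin 3) ℂ) (i : Fin 3) :
    ContDiff ℝ ∞ fun z => projectiveImage M z i := by
  have h : (fun z => projectiveImage M z i) = fun z : CPlane =>
      (M : Matrix (Fin 3) (Fin 3) ℂ) i 0 + (M : Matrix (Fin 3) (Fin 3) ℂ) i 1 * z 0
        + (M : Matrix (Fin 3) (Fin 3) ℂ) i 2 * z 1 := by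
    ext z
    simp [projectiveImage, Matrix.mulVec, dotProduct, Fin.sum_univ_three]
  rw [h]
  fun_prop

theorem contDiffAt_projectiveMap {M : GL (Fin 3) ℂ} {p : CPlane}
    (hp : projectiveImage M p 0 ≠ 0) : ContDiffAt ℝ ∞ (projectiveMap M) p := by
  refine contDiffAt_pi.2 fun j => ?_
  simp only [projectiveMap, div_eq_mul_inv]
  exact (contDiff_projectiveImage M _).contDiffAt.mul
    ((contDiff_projectiveImage M 0).contDiffAt.inv hp)

/-- Complex tangent vectors of a strongly `ℂ`-convex hypersurface have positive Hessian for some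
function that vanishes on the hypersurface: the pull-back of the defining function of a strongly
convex image. Projective maps send lines to lines, so that the pull-back of the Hessian differs
from the Hessian of the pull-back by the differential on a complex tangent vector. -/
theorem IsStronglyCConvex.exists_hessian_pos {S : Set CPlane} (hS : IsRealHypersurface S)
    (hconv : IsStronglyCConvex S) {p : CPlane} (hp : p ∈ S) :
    ∃ (N : Set CPlane) (τ : CPlane → ℝ), IsOpen N ∧ p ∈ N ∧ ContDiffOn ℝ ∞ τ N ∧
      (∀ q ∈ S ∩ N, τ q = 0) ∧
      ∀ v ∈ realTangentSpace S p, Complex.I • v ∈ realTangentSpace S p → v ≠ 0 →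
        0 < fderiv ℝ (fderiv ℝ τ) p v v := by
  obtain ⟨U, hU, hpU, M, hM, hS', hconv'⟩ := hconv p hp
  set S' := projectiveMap M '' (S ∩ U) with hS'def
  have hpS' : projectiveMap M p ∈ S' := ⟨p, ⟨hp, hpU⟩, rfl⟩
  obtain ⟨ρ, hρ, hpos⟩ := hconv' _ hpS'
  have hlam := hM p ⟨hp, hpU⟩
  have hMp := contDiffAt_projectiveMap hlam
  -- Tangent vectors of `S` are mapped to tangent vectors of the image.
  have htan : ∀ v ∈ realTangentSpace S p,
      fderiv ℝ (projectiveMap M) p v ∈ realTangentSpace S' (projectiveMap M p) := by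
    rintro v hv σ ⟨V, hV, hσ⟩
    have hσd := ((hσ.smooth.contDiffAt (hσ.isOpen.mem_nhds hV)).differentiableAt
      (by simp)).hasFDerivAt
    have hcomp := hσd.comp p (hMp.differentiableAt (by simp)).hasFDerivAt
    have h0 := hS.fderiv_apply_eq_zero hp (G := σ ∘ projectiveMap M) hcomp.differentiableAt (by
      filter_upwards [self_mem_nhdsWithin, mem_nhdsWithin_of_mem_nhds (hU.mem_nhds hpU),
        mem_nhdsWithin_of_mem_nhds (hMp.continuousAt.preimage_mem_nhds (hσ.isOpen.mem_nhds hV))]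
        with q hqS hqU hqV
      exact (hσ.zero_iff _ hqV).1 ⟨q, ⟨hqS, hqU⟩, rfl⟩) hv
    rwa [hcomp.fderiv] at h0
  obtain ⟨V, hpV, hρV⟩ := hρ
  let N : Set CPlane := U ∩ ({q | projectiveImage M q 0 ≠ 0} ∩ projectiveMap M ⁻¹' V)
  have hNo : IsOpen N := hU.inter (ContinuousOn.isOpen_inter_preimage
    (fun q hq => (contDiffAt_projectiveMap hq).continuousAt.continuousWithinAt)
    (isOpen_ne.preimage (contDiff_projectiveImage M 0).continuous) hρV.isOpen)
  have hpN : p ∈ N := ⟨hpU, hlam, hpV⟩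
  have hτ : ContDiffOn ℝ ∞ (fun q => ρ (projectiveMap M q)) N := fun q hq =>
    ((hρV.smooth.contDiffAt (hρV.isOpen.mem_nhds hq.2.2)).comp q
      (contDiffAt_projectiveMap hq.2.1)).contDiffWithinAt
  refine ⟨N, fun q => ρ (projectiveMap M q), hNo, hpN, hτ, fun q hq =>
    (hρV.zero_iff _ hq.2.2.2).1 ⟨q, ⟨hq.1, hq.2.1⟩, rfl⟩, fun v hv hIv hv0 => ?_⟩
  set lam := projectiveImage M p 0 with hlamdef
  set μ := Matrix.mulVec (M : Matrix (Fin 3) (Fin 3) ℂ) (Matrix.vecCons 0 v) 0 with hμ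
  set e := projectiveDirection M p v with he
  have he0 : e ≠ 0 := projectiveDirection_ne_zero hlam hv0
  have hden : ∀ᶠ t : ℝ in nhds 0, lam + (t : ℂ) * μ ≠ 0 := by
    have : ContinuousAt (fun t : ℝ => lam + (t : ℂ) * μ) 0 := by fun_prop
    exact this.eventually_ne (by simpa using hlam)
  have hline : ∀ᶠ t : ℝ in nhds 0, projectiveMap M (p + t • v)
      = projectiveMap M p + ((t : ℂ) / (lam + (t : ℂ) * μ)) • e := by
    filter_upwards [hden] with t ht
    exact projectiveMap_add_smul (s := (t : ℂ)) hlam (by rwa [projectiveImage_add_smul])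
  have hγ : ∀ᶠ t : ℝ in nhds 0, HasDerivAt
      (fun t : ℝ => projectiveMap M p + ((t : ℂ) / (lam + (t : ℂ) * μ)) • e)
      ((lam / (lam + (t : ℂ) * μ) ^ 2) • e) t := by
    filter_upwards [hden] with t ht
    have h1 : HasDerivAt (fun t : ℝ => (t : ℂ)) 1 t := Complex.ofRealCLM.hasDerivAt
    have h2 := (h1.div ((h1.mul_const μ).const_add lam) ht).smul_const e
    refine (h2.const_add (projectiveMap M p)).congr_deriv ?_
    congr 1
    ring
  have hγ' : HasDerivAt (fun t : ℝ => (lam / (lam + (t : ℂ) * μ) ^ 2) • e)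
      ((-2 * μ / lam ^ 2) • e) 0 := by
    have h1 : HasDerivAt (fun t : ℝ => (t : ℂ)) 1 0 := Complex.ofRealCLM.hasDerivAt
    have h2 := (((hasDerivAt_const (0 : ℝ) lam).div (((h1.mul_const μ).const_add lam).pow 2)
      (by simpa using hlam)).smul_const e)
    refine h2.congr_deriv ?_
    congr 1
    simp
    field_simp
  have hlin : ∀ t : ℝ, HasDerivAt (fun t : ℝ => p + t • v) v t := fun t => by
    simpa using ((hasDerivAt_id t).smul_const v).const_add p
  have hNe : N ∈ nhds p := hNo.mem_nhds hpN
  have hVe := hρV.isOpen.mem_nhds hpV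
  have hleft := deriv_deriv_comp_curve (ρ := fun q => ρ (projectiveMap M q))
    (γ := fun t : ℝ => p + t • v) (γ' := fun _ => v) (γ'' := 0)
    (by
      simp only [zero_smul, add_zero]
      filter_upwards [hNe] with q hq
      exact (hτ.contDiffAt (hNo.mem_nhds hq)).differentiableAt (by simp))
    (by
      simp only [zero_smul, add_zero]
      exact ((hτ.fderiv_of_isOpen hNo (m := ∞) (by simp)).contDiffAt hNe).differentiableAt
        (by simp))
    (Filter.Eventually.of_forall hlin) (hasDerivAt_const _ _)
  have hright := deriv_deriv_comp_curve (ρ := ρ)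
    (by
      simp only [Complex.ofReal_zero, zero_div, zero_smul, add_zero]
      filter_upwards [hVe] with q hq
      exact (hρV.smooth.contDiffAt (hρV.isOpen.mem_nhds hq)).differentiableAt (by simp))
    (by
      simp only [Complex.ofReal_zero, zero_div, zero_smul, add_zero]
      exact ((hρV.smooth.fderiv_of_isOpen hρV.isOpen (m := ∞) (by simp)).contDiffAt
        hVe).differentiableAt (by simp)) hγ hγ'
  -- All complex multiples of `e` are tangent to the image.
  have hDv : ∀ s : ℂ, s • v ∈ realTangentSpace S p →
      (s / lam) • e ∈ realTangentSpace S' (projectiveMap M p) := by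
    intro s hs
    have h1 : HasDerivAt (fun t : ℝ => (t : ℂ) * s) (1 * s) 0 :=
      (Complex.ofRealCLM.hasDerivAt (x := (0 : ℝ))).mul_const s
    have hcont : ContinuousAt (fun t : ℝ => lam + (t : ℂ) * s * μ) 0 := by fun_prop
    have hne : lam + ((0 : ℝ) : ℂ) * s * μ ≠ 0 := by simpa using hlam
    have h2 := ((h1.div ((h1.mul_const μ).const_add lam) hne).smul_const e).const_add
      (projectiveMap M p)
    have h3 : HasDerivAt (fun t : ℝ => projectiveMap M (p + t • (s • v))) ((s / lam) • e) 0 := by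
      refine (h2.congr_deriv ?_).congr_of_eventuallyEq ?_
      · congr 1
        simp
        field_simp
      · filter_upwards [hcont.eventually_ne hne] with t ht
        have h4 : t • (s • v) = ((t : ℂ) * s) • v := by rw [← Complex.coe_smul, smul_smul]
        rw [h4]
        exact projectiveMap_add_smul hlam (by rwa [projectiveImage_add_smul])
    have hlin : HasDerivAt (fun t : ℝ => p + t • (s • v)) (s • v) 0 := by
      simpa using ((hasDerivAt_id (0 : ℝ)).smul_const (s • v)).const_add p
    have hMd : HasFDerivAt (projectiveMap M) (fderiv ℝ (projectiveMap M) p)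
        (p + (0 : ℝ) • (s • v)) := by
      simpa using (hMp.differentiableAt (by simp)).hasFDerivAt
    have h5 : HasDerivAt (projectiveMap M ∘ fun t : ℝ => p + t • (s • v)) _ 0 :=
      hMd.comp_hasDerivAt (0 : ℝ) hlin
    rw [← h5.unique h3]
    exact htan _ hs
  have hE : ∀ c : ℂ, c • e ∈ realTangentSpace S' (projectiveMap M p) := by
    intro c
    have h1 := hDv 1 (by simpa using hv)
    have h2 := hDv Complex.I hIv
    have : c • e = (c * lam).re • ((1 / lam) • e) + (c * lam).im • ((Complex.I / lam) • e) := by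
      rw [← Complex.coe_smul, ← Complex.coe_smul, smul_smul, smul_smul, ← add_smul]
      congr 1
      field_simp
      rw [Complex.re_add_im]
    rw [this]
    exact add_mem (Submodule.smul_mem _ _ h1) (Submodule.smul_mem _ _ h2)
  have hcurve : (fun t : ℝ => ρ (projectiveMap M (p + t • v))) =ᶠ[nhds 0]
      fun t : ℝ => ρ (projectiveMap M p + ((t : ℂ) / (lam + (t : ℂ) * μ)) • e) := by
    filter_upwards [hline] with t ht
    rw [ht]
  rw [hcurve.deriv.deriv_eq, hright] at hleft
  simp only [Complex.ofReal_zero, zero_div, zero_smul, add_zero, zero_mul, map_zero] at hleft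
  rw [← hleft, hE _ ρ ⟨V, hpV, hρV⟩, add_zero]
  exact hpos _ (hE _) (smul_ne_zero (div_ne_zero hlam (pow_ne_zero 2 hlam)) he0)

/-- The Hessian of any defining function is definite on the maximal complex subspace. -/
theorem IsStronglyCConvex.exists_hessian_definite {S : Set CPlane} (hS : IsRealHypersurface S)
    (hconv : IsStronglyCConvex S) {p : CPlane} (hp : p ∈ S) {ρ : CPlane → ℝ}
    (hρ : IsDefiningFunctionAt S p ρ) :
    ∃ k : ℝ, ∀ v ∈ realTangentSpace S p, Complex.I • v ∈ realTangentSpace S p → v ≠ 0 →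
      0 < k * fderiv ℝ (fderiv ℝ ρ) p v v := by
  obtain ⟨N, τ, hN, hpN, hτ, hτ0, hpos⟩ := hconv.exists_hessian_pos hS hp
  obtain ⟨v0, hv0⟩ := hρ.exists_fderiv_eq_one hp
  obtain ⟨U, hpU, hρ⟩ := hρ
  refine ⟨fderiv ℝ τ p v0, fun v hv hIv hne => ?_⟩
  have hτker : ∀ q ∈ S ∩ N, ∀ w ∈ realTangentSpace S q, fderiv ℝ τ q w = 0 := by
    rintro q ⟨hqS, hqN⟩ w hw
    refine hS.fderiv_apply_eq_zero hqS
      ((hτ.contDiffAt (hN.mem_nhds hqN)).differentiableAt (by simp)) ?_ hw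
    filter_upwards [self_mem_nhdsWithin, mem_nhdsWithin_of_mem_nhds (hN.mem_nhds hqN)]
      with x hxS hxN using hτ0 x ⟨hxS, hxN⟩
  have hD1 : HasFDerivAt (fderiv ℝ τ) (fderiv ℝ (fderiv ℝ τ) p) p :=
    (((hτ.fderiv_of_isOpen hN (m := ∞) (by simp)).contDiffAt (hN.mem_nhds hpN)).differentiableAt
      (by simp)).hasFDerivAt
  have hD2 : HasFDerivAt (fderiv ℝ ρ) (fderiv ℝ (fderiv ℝ ρ) p) p :=
    (((hρ.smooth.fderiv_of_isOpen hρ.isOpen (m := ∞) (by simp)).contDiffAt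
      (hρ.isOpen.mem_nhds hpU)).differentiableAt (by simp)).hasFDerivAt
  have e1 := fun w => hD1.clm_apply (hasFDerivAt_const w p)
  have e2 := fun w => hD2.clm_apply (hasFDerivAt_const w p)
  -- On `S` the two differentials are proportional; this relation is differentiated along `v`.
  have hG := ((e1 v).mul (e2 v0)).sub ((e2 v).mul (e1 v0))
  have h0 := hS.fderiv_apply_eq_zero hp hG.differentiableAt (by
    filter_upwards [self_mem_nhdsWithin, mem_nhdsWithin_of_mem_nhds (hN.mem_nhds hpN),
      mem_nhdsWithin_of_mem_nhds (hρ.isOpen.mem_nhds hpU)] with q hqS hqN hqU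
    have hw : fderiv ℝ ρ q v0 • v - fderiv ℝ ρ q v • v0 ∈ realTangentSpace S q :=
      ((hρ.at hqU).mem_realTangentSpace_iff hqS).2 (by simp [mul_comm])
    have := hτker q ⟨hqS, hqN⟩ _ hw
    simp only [map_sub, map_smul, smul_eq_mul] at this
    simp only [Pi.sub_apply, Pi.mul_apply]
    linarith) hv
  rw [hG.fderiv] at h0
  have hτv := hτker p ⟨hp, hpN⟩ v hv
  have hρv := hv ρ (hρ.at hpU)
  simp [hτv, hρv, hv0] at h0
  have := hpos v hv hIv hne
  linarith

/-- The Gauss map `(w_1, w_2)` is an immersion of `S`. -/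
theorem eq_zero_of_fderivWithin_dualCoord {S : Set CPlane} (hS : IsRealHypersurface S)
    (hconv : IsStronglyCConvex S) (h0 : NoComplexTangentLineThroughZero S) {p : CPlane}
    (hp : p ∈ S) {v : CPlane} (hv : v ∈ realTangentSpace S p)
    (hw : ∀ j, fderivWithin ℝ (dualCoord S j) S p v = 0) : v = 0 := by
  obtain ⟨ρ, hρ⟩ := hS p hp
  have hwd : ∀ j, HasFDerivWithinAt (dualCoord S j) (fderivWithin ℝ (dualCoord S j) S p) S p :=
    fun j => ((contDiffOn_dualCoord hS h0 j).differentiableOn (by simp) p hp).hasFDerivWithinAt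
  have hz : ∀ j : Fin 2, HasFDerivWithinAt (fun z : CPlane => z j)
      (ContinuousLinearMap.proj j) S p := fun j =>
    (ContinuousLinearMap.proj (R := ℝ) (φ := fun _ : Fin 2 => ℂ) j).hasFDerivWithinAt
  have h1 := hS.fderivWithin_apply hp (((hz 0).mul (hwd 0)).add ((hz 1).mul (hwd 1))) hv
  have h2 : fderivWithin ℝ ((fun z : CPlane => z 0) * dualCoord S 0
      + (fun z : CPlane => z 1) * dualCoord S 1) S p v = 0 := by
    have hone : Set.EqOn ((fun z : CPlane => z 0) * dualCoord S 0
        + (fun z : CPlane => z 1) * dualCoord S 1) (fun _ => 1) S :=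
      fun q hq => mul_dualCoord_sum hS h0 hq
    rw [fderivWithin_congr hone (hone hp),
      hS.fderivWithin_apply hp (hasFDerivWithinAt_const 1 p S) hv]
    rfl
  rw [h2] at h1
  simp [hw] at h1
  have hH : v 0 * dualCoord S 0 p + v 1 * dualCoord S 1 p = 0 := by linear_combination -h1
  have hIv := ((dualCoord_annihilates_iff hS h0 hp v).1 hH).2
  have h3 := sum_fderivWithin_dualCoord_mul hS h0 hp hρ hv hH
  rw [hw, hw] at h3
  have hre := congrArg Complex.re h3
  simp at hre
  obtain ⟨k, hk⟩ := hconv.exists_hessian_definite hS hp hρ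
  by_contra hne
  have := hk v hv hIv hne
  rw [show fderiv ℝ (fderiv ℝ ρ) p v v = 0 by linarith, mul_zero] at this
  exact lt_irrefl _ this

/-- A complex tangent vector is determined by its values on `z_1, z_2, w_1, w_2`. -/
theorem eq_zero_of_derivAlong_dualCoord {S : Set CPlane} (hS : IsRealHypersurface S)
    (hconv : IsStronglyCConvex S) (h0 : NoComplexTangentLineThroughZero S) {p : CPlane}
    (hp : p ∈ S) {V : CVec} (hV : V ∈ complexifiedTangentSpace S p) (hz : V.1 = 0)
    (hw : ∀ j, derivAlong S (dualCoord S j) p V = 0) : V = 0 := by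
  obtain ⟨ρ, hρ⟩ := hS p hp
  obtain ⟨k, hk⟩ := hconv.exists_hessian_definite hS hp hρ
  set A := V.realPart with hA
  -- A vector of type `(0,1)` has the form `A + i (i A)`.
  have hB : V.imagPart = Complex.I • A := by
    have h := V.realPart_add_I_smul_imagPart
    rw [hz] at h
    rw [hA, eq_neg_of_add_eq_zero_left h, smul_neg, smul_smul, Complex.I_mul_I, neg_one_smul,
      neg_neg]
  have hAT : A ∈ realTangentSpace S p := hV.1
  have hIA : Complex.I • A ∈ realTangentSpace S p := hB ▸ hV.2
  have hIIA : Complex.I • Complex.I • A = -A := by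
    rw [smul_smul, Complex.I_mul_I, neg_one_smul]
  have hH1 := (dualCoord_annihilates_iff hS h0 hp A).2 ⟨hAT, hIA⟩
  have hH2 := (dualCoord_annihilates_iff hS h0 hp (Complex.I • A)).2
    ⟨hIA, hIIA ▸ neg_mem hAT⟩
  have h1 := sum_fderivWithin_dualCoord_mul hS h0 hp hρ hAT hH1
  have h2 := sum_fderivWithin_dualCoord_mul hS h0 hp hρ hIA hH2
  have hw0 := hw 0
  have hw1 := hw 1
  rw [derivAlong, hB] at hw0 hw1
  rw [hIIA] at h2
  simp only [Pi.smul_apply, smul_eq_mul] at h2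
  have h3 : ((fderiv ℝ (fderiv ℝ ρ) p A A : ℝ) : ℂ)
      - Complex.I * (fderiv ℝ (fderiv ℝ ρ) p A (Complex.I • A) : ℝ)
      + ((fderiv ℝ (fderiv ℝ ρ) p (Complex.I • A) (Complex.I • A) : ℝ)
      - Complex.I * (fderiv ℝ (fderiv ℝ ρ) p (Complex.I • A) (-A) : ℝ)) = 0 := by
    linear_combination (-2 : ℂ) * h1 - 2 * h2
      + 2 * (∑ k, p k * wirtingerDeriv ρ k p) * (A 0 * hw0 + A 1 * hw1)
  have hre := congrArg Complex.re h3
  simp only [Complex.add_re, Complex.sub_re, Complex.ofReal_re, Complex.I_mul_re,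
    Complex.ofReal_im, Complex.zero_re, neg_zero, sub_zero] at hre
  have hA0 : A = 0 := by
    by_contra hne
    have k1 := hk A hAT hIA hne
    have k2 := hk (Complex.I • A) hIA (hIIA ▸ neg_mem hAT) (smul_ne_zero Complex.I_ne_zero hne)
    have := add_pos k1 k2
    rw [← mul_add, hre, mul_zero] at this
    exact lt_irrefl _ this
  refine Prod.ext hz (funext fun j => ?_)
  have := congrFun (hA.symm.trans hA0) j
  simpa [CVec.realPart, hz] using this

/-! ### The fields `X` and `T` -/

theorem contDiffOn_coord (S : Set CPlane) (j : Fin 2) :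
    ContDiffOn ℝ ∞ (fun z : CPlane => z j) S :=
  (contDiff_apply ℝ ℂ j).contDiffOn

theorem fieldApply_congr {S : Set CPlane} (X : CPlane → CVec) {u v : CPlane → ℂ}
    (h : Set.EqOn u v S) {p : CPlane} (hp : p ∈ S) : fieldApply S X u p = fieldApply S X v p :=
  derivAlong_congr h hp _

/-- The derivative of the relation `z_1 w_1 + z_2 w_2 = 1`. -/
theorem mul_derivAlong_dualCoord_sum {S : Set CPlane} (hS : IsRealHypersurface S)
    (h0 : NoComplexTangentLineThroughZero S) {p : CPlane} (hp : p ∈ S) {V : CVec}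
    (hV : V ∈ complexifiedTangentSpace S p) :
    p 0 * derivAlong S (dualCoord S 0) p V + p 1 * derivAlong S (dualCoord S 1) p V
      = -(dualCoord S 0 p * V.1 0 + dualCoord S 1 p * V.1 1) := by
  have hz := contDiffOn_coord S
  have hw := contDiffOn_dualCoord hS h0
  have h1 := derivAlong_add hS hp ((hz 0).mul (hw 0)) ((hz 1).mul (hw 1)) hV
  have h2 : derivAlong S (fun q => q 0 * dualCoord S 0 q + q 1 * dualCoord S 1 q) p V = 0 := by
    rw [derivAlong_congr (v := fun _ => 1) (fun q hq => mul_dualCoord_sum hS h0 hq) hp,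
      derivAlong_const hS hp 1 hV]
  rw [derivAlong_mul hS hp (hz 0) (hw 0) hV, derivAlong_mul hS hp (hz 1) (hw 1) hV,
    derivAlong_fst hS hp hV, derivAlong_fst hS hp hV] at h1
  linear_combination h2 - h1

theorem mk_zero_mem_complexifiedTangentSpace {S : Set CPlane} (hS : IsRealHypersurface S)
    (h0 : NoComplexTangentLineThroughZero S) {p : CPlane} (hp : p ∈ S) {t : CPlane}
    (ht : t 0 * dualCoord S 0 p + t 1 * dualCoord S 1 p = 0) :
    ((t, 0) : CVec) ∈ complexifiedTangentSpace S p := by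
  have h : ∀ c : ℂ, c • t ∈ realTangentSpace S p := fun c =>
    ((dualCoord_annihilates_iff hS h0 hp _).1 (by
      simp only [Pi.smul_apply, smul_eq_mul]; linear_combination c * ht)).1
  have h1 : CVec.realPart (t, 0) = (1 / 2 : ℂ) • t := by
    ext j; simp [CVec.realPart]; ring
  have h2 : CVec.imagPart (t, 0) = (1 / (2 * Complex.I) : ℂ) • t := by
    ext j
    simp only [CVec.imagPart, Pi.zero_apply, map_zero, sub_zero, Pi.smul_apply, smul_eq_mul]
    ring
  exact ⟨h1 ▸ h _, h2 ▸ h _⟩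

theorem zero_mk_mem_complexifiedTangentSpace {S : Set CPlane} (hS : IsRealHypersurface S)
    (h0 : NoComplexTangentLineThroughZero S) {p : CPlane} (hp : p ∈ S) {t : CPlane}
    (ht : t 0 * dualCoord S 0 p + t 1 * dualCoord S 1 p = 0) :
    ((0, fun j => conj (t j)) : CVec) ∈ complexifiedTangentSpace S p := by
  have h : ∀ c : ℂ, c • t ∈ realTangentSpace S p := fun c =>
    ((dualCoord_annihilates_iff hS h0 hp _).1 (by
      simp only [Pi.smul_apply, smul_eq_mul]; linear_combination c * ht)).1
  have h1 : CVec.realPart (0, fun j => conj (t j)) = (1 / 2 : ℂ) • t := by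
    ext j; simp [CVec.realPart]; ring
  have h2 : CVec.imagPart (0, fun j => conj (t j)) = (-1 / (2 * Complex.I) : ℂ) • t := by
    ext j; simp [CVec.imagPart]; ring
  exact ⟨h1 ▸ h _, h2 ▸ h _⟩

/-- The holomorphic part `(w_2, -w_1)` of `T`, a generator of the maximal complex subspace. -/
noncomputable def complexTangent (S : Set CPlane) (p : CPlane) : CPlane :=
  ![dualCoord S 1 p, -dualCoord S 0 p]

theorem contDiffOn_complexTangent {S : Set CPlane} (hS : IsRealHypersurface S)
    (h0 : NoComplexTangentLineThroughZero S) : ContDiffOn ℝ ∞ (complexTangent S) S := by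
  refine contDiffOn_pi.2 fun j => ?_
  fin_cases j
  · exact contDiffOn_dualCoord hS h0 1
  · exact (contDiffOn_dualCoord hS h0 0).neg

theorem complexTangent_annihilates (S : Set CPlane) (p : CPlane) :
    complexTangent S p 0 * dualCoord S 0 p + complexTangent S p 1 * dualCoord S 1 p = 0 := by
  simp [complexTangent]
  ring

theorem complexTangent_ne_zero {S : Set CPlane} (hS : IsRealHypersurface S)
    (h0 : NoComplexTangentLineThroughZero S) {p : CPlane} (hp : p ∈ S) :
    complexTangent S p ≠ 0 := by
  intro h
  have h1 := congrFun h 0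
  have h2 := congrFun h 1
  simp [complexTangent] at h1 h2
  simpa [h1, h2] using mul_dualCoord_sum hS h0 hp

theorem exists_isFieldX {S : Set CPlane} (hS : IsRealHypersurface S) (hconv : IsStronglyCConvex S)
    (h0 : NoComplexTangentLineThroughZero S) : ∃ X, IsFieldX S X := by
  have hw := contDiffOn_dualCoord hS h0
  let V : CPlane → CVec := fun p => (0, fun j => conj (complexTangent S p j))
  have hV : IsTangentialField S V := by
    refine ⟨contDiffOn_const.prodMk (contDiffOn_pi.2 fun j => ?_), fun p hp =>
      zero_mk_mem_complexifiedTangentSpace hS h0 hp (complexTangent_annihilates S p)⟩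
    exact Complex.conjCLE.contDiff.comp_contDiffOn
      ((contDiff_apply ℝ ℂ j).comp_contDiffOn (contDiffOn_complexTangent hS h0))
  -- `V w = μ (z_2, -z_1)`, and `μ` does not vanish because the Levi form does not.
  let μ : CPlane → ℂ := fun p => fieldApply S V (dualCoord S 0) p * dualCoord S 1 p
    - fieldApply S V (dualCoord S 1) p * dualCoord S 0 p
  have hμ : ContDiffOn ℝ ∞ μ S := ((contDiffOn_fieldApply hS hV (hw 0)).mul (hw 1)).sub
    ((contDiffOn_fieldApply hS hV (hw 1)).mul (hw 0))
  have hrel : ∀ p ∈ S, p 0 * fieldApply S V (dualCoord S 0) p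
      + p 1 * fieldApply S V (dualCoord S 1) p = 0 := fun p hp => by
    exact (mul_derivAlong_dualCoord_sum hS h0 hp (hV.2 p hp)).trans (by simp [V])
  have hV0 : ∀ p ∈ S, fieldApply S V (dualCoord S 0) p = μ p * p 1 := fun p hp => by
    simp only [μ]
    linear_combination dualCoord S 0 p * hrel p hp
      - fieldApply S V (dualCoord S 0) p * mul_dualCoord_sum hS h0 hp
  have hV1 : ∀ p ∈ S, fieldApply S V (dualCoord S 1) p = -(μ p * p 0) := fun p hp => by
    simp only [μ]
    linear_combination dualCoord S 1 p * hrel p hp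
      - fieldApply S V (dualCoord S 1) p * mul_dualCoord_sum hS h0 hp
  have hμ0 : ∀ p ∈ S, μ p ≠ 0 := by
    intro p hp h
    have hz : V p = 0 := by
      refine eq_zero_of_derivAlong_dualCoord hS hconv h0 hp (hV.2 p hp) rfl fun j => ?_
      fin_cases j
      · exact (hV0 p hp).trans (by rw [h, zero_mul])
      · exact (hV1 p hp).trans (by rw [h, zero_mul, neg_zero])
    refine complexTangent_ne_zero hS h0 hp (funext fun j => ?_)
    simpa [V] using congrFun (congrArg Prod.snd hz) j
  have happ : ∀ (u : CPlane → ℂ) (p : CPlane),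
      fieldApply S (fun p => (μ p)⁻¹ • V p) u p = (μ p)⁻¹ * fieldApply S V u p :=
    fun u p => derivAlong_smul_vec S u p _ _
  refine ⟨fun p => (μ p)⁻¹ • V p, ⟨(hμ.inv hμ0).smul hV.1, fun p hp =>
    Submodule.smul_mem _ _ (hV.2 p hp)⟩, fun j p hp => ?_, fun p hp => ?_, fun p hp => ?_⟩
  · rw [happ, fieldApply, derivAlong_fst hS hp (hV.2 p hp)]
    simp [V]
  · rw [happ, hV0 p hp]
    field_simp [hμ0 p hp]
  · rw [happ, hV1 p hp]
    field_simp [hμ0 p hp]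

theorem exists_isFieldT {S : Set CPlane} (hS : IsRealHypersurface S)
    (h0 : NoComplexTangentLineThroughZero S) {X : CPlane → CVec} (hX : IsFieldX S X) :
    ∃ T, IsFieldT S T := by
  have hw := contDiffOn_dualCoord hS h0
  let V : CPlane → CVec := fun p => (complexTangent S p, 0)
  have hV : IsTangentialField S V :=
    ⟨(contDiffOn_complexTangent hS h0).prodMk contDiffOn_const, fun p hp =>
      mk_zero_mem_complexifiedTangentSpace hS h0 hp (complexTangent_annihilates S p)⟩
  -- `V w = c (z_2, -z_1) = c X w`.
  let c : CPlane → ℂ := fun p => fieldApply S V (dualCoord S 0) p * dualCoord S 1 p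
    - fieldApply S V (dualCoord S 1) p * dualCoord S 0 p
  have hc : ContDiffOn ℝ ∞ c S := ((contDiffOn_fieldApply hS hV (hw 0)).mul (hw 1)).sub
    ((contDiffOn_fieldApply hS hV (hw 1)).mul (hw 0))
  have hrel : ∀ p ∈ S, p 0 * fieldApply S V (dualCoord S 0) p
      + p 1 * fieldApply S V (dualCoord S 1) p = 0 := fun p hp => by
    refine (mul_derivAlong_dualCoord_sum hS h0 hp (hV.2 p hp)).trans ?_
    linear_combination -complexTangent_annihilates S p
  have happ : ∀ (u : CPlane → ℂ) (p : CPlane),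
      fieldApply S (fun p => V p - c p • X p) u p
        = fieldApply S V u p - c p * fieldApply S X u p :=
    fun u p => by
      rw [fieldApply, derivAlong_sub_vec, derivAlong_smul_vec]
      rfl
  refine ⟨fun p => V p - c p • X p, ⟨hV.1.sub (hc.smul hX.tangential.1), fun p hp =>
    Submodule.sub_mem _ (hV.2 p hp) (Submodule.smul_mem _ _ (hX.tangential.2 p hp))⟩,
    fun p hp => ?_, fun p hp => ?_, fun j p hp => ?_⟩
  · rw [happ, hX.apply_z 0 p hp, fieldApply, derivAlong_fst hS hp (hV.2 p hp)]
    simp [V, complexTangent]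
  · rw [happ, hX.apply_z 1 p hp, fieldApply, derivAlong_fst hS hp (hV.2 p hp)]
    simp [V, complexTangent]
  · fin_cases j
    · simp only [happ, Fin.zero_eta, hX.apply_w0 p hp, c]
      linear_combination (-fieldApply S V (dualCoord S 0) p) * mul_dualCoord_sum hS h0 hp
        + dualCoord S 0 p * hrel p hp
    · simp only [happ, Fin.mk_one, hX.apply_w1 p hp, c]
      linear_combination (-fieldApply S V (dualCoord S 1) p) * mul_dualCoord_sum hS h0 hp
        + dualCoord S 1 p * hrel p hp

/-- A tangential field is determined by its action on `z_1, z_2, w_1, w_2`. -/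
theorem eq_of_fieldApply_eq {S : Set CPlane} (hS : IsRealHypersurface S)
    (hconv : IsStronglyCConvex S) (h0 : NoComplexTangentLineThroughZero S) {p : CPlane}
    (hp : p ∈ S) {V W : CVec} (hV : V ∈ complexifiedTangentSpace S p)
    (hW : W ∈ complexifiedTangentSpace S p) (hz : ∀ j, V.1 j = W.1 j)
    (hw : ∀ j, derivAlong S (dualCoord S j) p V = derivAlong S (dualCoord S j) p W) : V = W := by
  refine sub_eq_zero.1 (eq_zero_of_derivAlong_dualCoord hS hconv h0 hp
    (Submodule.sub_mem _ hV hW) (funext fun j => ?_) fun j => ?_)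
  · simp [hz j]
  · rw [derivAlong_sub_vec, hw j, sub_self]

section Fields

variable {S : Set CPlane} {X T : CPlane → CVec}

theorem IsFieldX.fst_eq_zero (hX : IsFieldX S X) (hS : IsRealHypersurface S) {p : CPlane}
    (hp : p ∈ S) (j : Fin 2) : (X p).1 j = 0 := by
  rw [← derivAlong_fst hS hp (hX.tangential.2 p hp) j]
  exact hX.apply_z j p hp

theorem IsFieldT.fst_zero (hT : IsFieldT S T) (hS : IsRealHypersurface S) {p : CPlane}
    (hp : p ∈ S) : (T p).1 0 = dualCoord S 1 p := by
  rw [← derivAlong_fst hS hp (hT.tangential.2 p hp) 0]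
  exact hT.apply_z0 p hp

theorem IsFieldT.fst_one (hT : IsFieldT S T) (hS : IsRealHypersurface S) {p : CPlane}
    (hp : p ∈ S) : (T p).1 1 = -dualCoord S 0 p := by
  rw [← derivAlong_fst hS hp (hT.tangential.2 p hp) 1]
  exact hT.apply_z1 p hp

theorem IsFieldX.eqOn (hX : IsFieldX S X) (hS : IsRealHypersurface S)
    (hconv : IsStronglyCConvex S) (h0 : NoComplexTangentLineThroughZero S) {X' : CPlane → CVec}
    (hX' : IsFieldX S X') : Set.EqOn X' X S := by
  intro p hp
  refine eq_of_fieldApply_eq hS hconv h0 hp (hX'.tangential.2 p hp) (hX.tangential.2 p hp)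
    (fun j => by rw [hX.fst_eq_zero hS hp, hX'.fst_eq_zero hS hp]) fun j => ?_
  fin_cases j
  · exact (hX'.apply_w0 p hp).trans (hX.apply_w0 p hp).symm
  · exact (hX'.apply_w1 p hp).trans (hX.apply_w1 p hp).symm

theorem IsFieldT.eqOn (hT : IsFieldT S T) (hS : IsRealHypersurface S)
    (hconv : IsStronglyCConvex S) (h0 : NoComplexTangentLineThroughZero S) {T' : CPlane → CVec}
    (hT' : IsFieldT S T') : Set.EqOn T' T S := by
  intro p hp
  refine eq_of_fieldApply_eq hS hconv h0 hp (hT'.tangential.2 p hp) (hT.tangential.2 p hp)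
    (fun j => ?_) fun j => (hT'.apply_w j p hp).trans (hT.apply_w j p hp).symm
  fin_cases j
  · exact (hT'.fst_zero hS hp).trans (hT.fst_zero hS hp).symm
  · exact (hT'.fst_one hS hp).trans (hT.fst_one hS hp).symm

/-! ### The commutation relations -/

theorem fieldApply_zero_fun {S : Set CPlane} (hS : IsRealHypersurface S) {Z : CPlane → CVec}
    (hZ : IsTangentialField S Z) {u : CPlane → ℂ} (hu : ∀ q ∈ S, u q = 0) {p : CPlane}
    (hp : p ∈ S) : fieldApply S Z u p = 0 :=
  (fieldApply_congr Z (v := fun _ => 0) hu hp).trans (derivAlong_const hS hp 0 (hZ.2 p hp))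

/-- The bracket `Y = [X, T]` satisfies `Y z_j = -z_j`. -/
theorem fieldBracket_fst (hS : IsRealHypersurface S) (h0 : NoComplexTangentLineThroughZero S)
    (hX : IsFieldX S X) (hT : IsFieldT S T) {p : CPlane} (hp : p ∈ S) (j : Fin 2) :
    (fieldBracket S X T p).1 j = -p j := by
  have h2 : fieldApply S T (fun q => (X q).1 j) p = 0 :=
    fieldApply_zero_fun hS hT.tangential (fun q hq => hX.fst_eq_zero hS hq j) hp
  have h1 : fieldApply S X (fun q => (T q).1 j) p = -p j := by
    fin_cases j
    · exact (fieldApply_congr X (fun q hq => hT.fst_zero hS hq) hp).trans (hX.apply_w1 p hp)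
    · refine (fieldApply_congr X (fun q hq => hT.fst_one hS hq) hp).trans ?_
      rw [fieldApply, derivAlong_neg hS hp (contDiffOn_dualCoord hS h0 0) (hX.tangential.2 p hp)]
      exact congrArg _ (hX.apply_w0 p hp)
  simp [fieldBracket, h1, h2]

/-- The bracket `Y = [X, T]` satisfies `Y w_j = w_j`. -/
theorem fieldBracket_dualCoord (hS : IsRealHypersurface S)
    (h0 : NoComplexTangentLineThroughZero S) (hX : IsFieldX S X) (hT : IsFieldT S T)
    {p : CPlane} (hp : p ∈ S) (j : Fin 2) :
    fieldApply S (fieldBracket S X T) (dualCoord S j) p = dualCoord S j p := by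
  rw [fieldApply_fieldBracket hS hX.tangential hT.tangential (contDiffOn_dualCoord hS h0 j) hp,
    fieldApply_zero_fun hS hX.tangential (hT.apply_w j) hp, zero_sub]
  fin_cases j
  · exact (congrArg _ (fieldApply_congr T hX.apply_w0 hp)).trans
      (neg_eq_iff_eq_neg.2 (hT.apply_z1 p hp))
  · refine (congrArg _ (fieldApply_congr T hX.apply_w1 hp)).trans ?_
    rw [fieldApply, derivAlong_neg hS hp (contDiffOn_coord S 0) (hT.tangential.2 p hp), neg_neg]
    exact hT.apply_z0 p hp

/-- The relation `[X, Y] = 2 X` for `Y = [X, T]`. -/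
theorem fieldBracket_X_Y (hS : IsRealHypersurface S) (hconv : IsStronglyCConvex S)
    (h0 : NoComplexTangentLineThroughZero S) (hX : IsFieldX S X) (hT : IsFieldT S T)
    {p : CPlane} (hp : p ∈ S) :
    fieldBracket S X (fieldBracket S X T) p = (2 : ℂ) • X p := by
  set Y := fieldBracket S X T with hYdef
  have hY : IsTangentialField S Y := isTangentialField_fieldBracket hS hX.tangential hT.tangential
  have hw := contDiffOn_dualCoord hS h0
  refine eq_of_fieldApply_eq hS hconv h0 hp
    ((isTangentialField_fieldBracket hS hX.tangential hY).2 p hp)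
    (Submodule.smul_mem _ _ (hX.tangential.2 p hp)) (fun j => ?_) fun j => ?_
  · have h1 : fieldApply S X (fun q => (Y q).1 j) p = 0 := by
      refine (fieldApply_congr X (fun q hq => fieldBracket_fst hS h0 hX hT hq j) hp).trans ?_
      rw [fieldApply, derivAlong_neg hS hp (contDiffOn_coord S j) (hX.tangential.2 p hp),
        neg_eq_zero]
      exact hX.apply_z j p hp
    have h2 : fieldApply S Y (fun q => (X q).1 j) p = 0 :=
      fieldApply_zero_fun hS hY (fun q hq => hX.fst_eq_zero hS hq j) hp
    simp only [fieldBracket, h1, h2, Prod.smul_fst, Pi.smul_apply, hX.fst_eq_zero hS hp]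
    simp
  · have h := fieldApply_fieldBracket hS hX.tangential hY (hw j) hp
    rw [fieldApply_congr X (fun q hq => fieldBracket_dualCoord hS h0 hX hT hq j) hp] at h
    rw [derivAlong_smul_vec]
    refine h.trans ?_
    fin_cases j
    · have h1 : fieldApply S Y (fieldApply S X (dualCoord S 0)) p = -p 1 := by
        rw [fieldApply_congr Y hX.apply_w0 hp, fieldApply, derivAlong_fst hS hp (hY.2 p hp)]
        exact fieldBracket_fst hS h0 hX hT hp 1
      have h2 := hX.apply_w0 p hp
      change fieldApply S X (dualCoord S 0) p - fieldApply S Y (fieldApply S X (dualCoord S 0)) p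
        = 2 * fieldApply S X (dualCoord S 0) p
      rw [h1, h2]
      ring
    · have h1 : fieldApply S Y (fieldApply S X (dualCoord S 1)) p = p 0 := by
        rw [fieldApply_congr Y hX.apply_w1 hp, fieldApply,
          derivAlong_neg hS hp (contDiffOn_coord S 0) (hY.2 p hp),
          derivAlong_fst hS hp (hY.2 p hp), fieldBracket_fst hS h0 hX hT hp 0, neg_neg]
      have h2 := hX.apply_w1 p hp
      change fieldApply S X (dualCoord S 1) p - fieldApply S Y (fieldApply S X (dualCoord S 1)) p
        = 2 * fieldApply S X (dualCoord S 1) p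
      rw [h1, h2]
      ring

/-- The relation `[T, Y] = -2 T` for `Y = [X, T]`. -/
theorem fieldBracket_T_Y (hS : IsRealHypersurface S) (hconv : IsStronglyCConvex S)
    (h0 : NoComplexTangentLineThroughZero S) (hX : IsFieldX S X) (hT : IsFieldT S T)
    {p : CPlane} (hp : p ∈ S) :
    fieldBracket S T (fieldBracket S X T) p = (-2 : ℂ) • T p := by
  set Y := fieldBracket S X T with hYdef
  have hY : IsTangentialField S Y := isTangentialField_fieldBracket hS hX.tangential hT.tangential
  have hw := contDiffOn_dualCoord hS h0
  refine eq_of_fieldApply_eq hS hconv h0 hp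
    ((isTangentialField_fieldBracket hS hT.tangential hY).2 p hp)
    (Submodule.smul_mem _ _ (hT.tangential.2 p hp)) (fun j => ?_) fun j => ?_
  · have h1 : fieldApply S T (fun q => (Y q).1 j) p = -(T p).1 j := by
      refine (fieldApply_congr T (fun q hq => fieldBracket_fst hS h0 hX hT hq j) hp).trans ?_
      rw [fieldApply, derivAlong_neg hS hp (contDiffOn_coord S j) (hT.tangential.2 p hp),
        derivAlong_fst hS hp (hT.tangential.2 p hp)]
    have h2 : fieldApply S Y (fun q => (T q).1 j) p = (T p).1 j := by
      fin_cases j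
      · refine (fieldApply_congr Y (fun q hq => hT.fst_zero hS hq) hp).trans ?_
        exact (fieldBracket_dualCoord hS h0 hX hT hp 1).trans (hT.fst_zero hS hp).symm
      · refine (fieldApply_congr Y (fun q hq => hT.fst_one hS hq) hp).trans ?_
        rw [fieldApply, derivAlong_neg hS hp (hw 0) (hY.2 p hp)]
        exact (congrArg _ (fieldBracket_dualCoord hS h0 hX hT hp 0)).trans (hT.fst_one hS hp).symm
    simp only [fieldBracket, h1, h2, Prod.smul_fst, Pi.smul_apply, smul_eq_mul]
    ring
  · have h := fieldApply_fieldBracket hS hT.tangential hY (hw j) hp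
    rw [fieldApply_congr T (fun q hq => fieldBracket_dualCoord hS h0 hX hT hq j) hp,
      fieldApply_zero_fun hS hY (hT.apply_w j) hp] at h
    rw [derivAlong_smul_vec]
    refine h.trans ?_
    have := hT.apply_w j p hp
    rw [fieldApply] at this ⊢
    rw [this]
    simp

/-- The fields `X`, `T` and `Y = [X, T]` form a frame of the complexified tangent space. -/
theorem eq_frame_combination (hS : IsRealHypersurface S) (hconv : IsStronglyCConvex S)
    (h0 : NoComplexTangentLineThroughZero S) (hX : IsFieldX S X) (hT : IsFieldT S T)
    {p : CPlane} (hp : p ∈ S) {V : CVec} (hV : V ∈ complexifiedTangentSpace S p) :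
    V = (dualCoord S 1 p * derivAlong S (dualCoord S 0) p V
        - dualCoord S 0 p * derivAlong S (dualCoord S 1) p V) • X p
      + (p 1 * V.1 0 - p 0 * V.1 1) • T p
      - (dualCoord S 0 p * V.1 0 + dualCoord S 1 p * V.1 1) • fieldBracket S X T p := by
  have hY := isTangentialField_fieldBracket hS hX.tangential hT.tangential
  have hone := mul_dualCoord_sum hS h0 hp
  have hrel := mul_derivAlong_dualCoord_sum hS h0 hp hV
  refine eq_of_fieldApply_eq hS hconv h0 hp hV (Submodule.sub_mem _ (Submodule.add_mem _
    (Submodule.smul_mem _ _ (hX.tangential.2 p hp))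
    (Submodule.smul_mem _ _ (hT.tangential.2 p hp)))
    (Submodule.smul_mem _ _ (hY.2 p hp))) (fun j => ?_) fun j => ?_
  · simp only [Prod.fst_sub, Prod.fst_add, Prod.smul_fst, Pi.sub_apply, Pi.add_apply,
      Pi.smul_apply, smul_eq_mul, hX.fst_eq_zero hS hp, fieldBracket_fst hS h0 hX hT hp]
    fin_cases j
    · simp only [Fin.zero_eta, hT.fst_zero hS hp]
      linear_combination (-V.1 0) * hone
    · simp only [Fin.mk_one, hT.fst_one hS hp]
      linear_combination (-V.1 1) * hone
  · have hYw := fieldBracket_dualCoord hS h0 hX hT hp j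
    have hTw := hT.apply_w j p hp
    rw [fieldApply] at hYw hTw
    rw [derivAlong_sub_vec, derivAlong_add_vec, derivAlong_smul_vec, derivAlong_smul_vec,
      derivAlong_smul_vec, hYw, hTw]
    fin_cases j
    · have hXw := hX.apply_w0 p hp
      rw [fieldApply] at hXw
      simp only [Fin.zero_eta, hXw]
      linear_combination (-derivAlong S (dualCoord S 0) p V) * hone + dualCoord S 0 p * hrel
    · have hXw := hX.apply_w1 p hp
      rw [fieldApply] at hXw
      simp only [Fin.mk_one, hXw]
      linear_combination (-derivAlong S (dualCoord S 1) p V) * hone + dualCoord S 1 p * hrel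

/-! ### CR and dual-CR functions -/

theorem isCRFunction_iff (hS : IsRealHypersurface S) (hconv : IsStronglyCConvex S)
    (h0 : NoComplexTangentLineThroughZero S) (hX : IsFieldX S X) (hT : IsFieldT S T)
    {f : CPlane → ℂ} :
    IsCRFunction S f ↔ ContDiffOn ℝ ∞ f S ∧ ∀ p ∈ S, fieldApply S X f p = 0 := by
  refine and_congr_right fun _ => forall₂_congr fun p hp => ⟨fun h => h _ ⟨hX.tangential.2 p hp,
    funext fun j => hX.fst_eq_zero hS hp j⟩, fun h V hV => ?_⟩
  have hV1 : V.1 = 0 := hV.2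
  rw [fieldApply] at h
  rw [eq_frame_combination hS hconv h0 hX hT hp hV.1, hV1]
  simp only [Pi.zero_apply, mul_zero, sub_zero, add_zero, zero_smul, derivAlong_smul_vec, h]

theorem CVec.realPart_conjugate (V : CVec) : V.conjugate.realPart = V.realPart := by
  ext j
  simp [CVec.realPart, CVec.conjugate, add_comm]

theorem CVec.imagPart_conjugate (V : CVec) : V.conjugate.imagPart = -V.imagPart := by
  ext j
  simp [CVec.imagPart, CVec.conjugate]
  ring

theorem CVec.eq_zero_of_parts {V : CVec} (h1 : V.realPart = 0) (h2 : V.imagPart = 0) : V = 0 := by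
  have h3 := V.realPart_add_I_smul_imagPart
  rw [h1, h2, smul_zero, add_zero] at h3
  refine Prod.ext h3.symm (funext fun j => ?_)
  have := congrFun h1 j
  simpa [CVec.realPart, ← h3] using this

theorem IsFieldT.ne_zero (hT : IsFieldT S T) (hS : IsRealHypersurface S)
    (h0 : NoComplexTangentLineThroughZero S) {p : CPlane} (hp : p ∈ S) : T p ≠ 0 := by
  intro h
  have h1 := hT.fst_zero hS hp
  have h2 := hT.fst_one hS hp
  rw [h] at h1 h2
  have := mul_dualCoord_sum hS h0 hp
  simp at h1 h2
  simp [← h1, h2] at this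

/-- The lines spanned by `T` form the dual CR structure. They contain no real vectors, since the
map `(w_1, w_2)`, whose differential annihilates `T`, is an immersion. -/
theorem isDualCRStructure_span (hS : IsRealHypersurface S) (hconv : IsStronglyCConvex S)
    (h0 : NoComplexTangentLineThroughZero S) (hT : IsFieldT S T) :
    IsDualCRStructure S fun p => Submodule.span ℂ {T p} := by
  have hspan : ∀ p ∈ S, ∀ V ∈ Submodule.span ℂ {T p}, ∀ j,
      derivAlong S (dualCoord S j) p V = 0 := by
    intro p hp V hV j
    obtain ⟨c, rfl⟩ := Submodule.mem_span_singleton.1 hV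
    have := hT.apply_w j p hp
    rw [fieldApply] at this
    rw [derivAlong_smul_vec, this, mul_zero]
  have htan : ∀ p ∈ S, Submodule.span ℂ {T p} ≤ complexifiedTangentSpace S p := fun p hp =>
    (Submodule.span_singleton_le_iff_mem _ _).2 (hT.tangential.2 p hp)
  refine ⟨⟨htan, fun p hp => ⟨Set.univ, isOpen_univ, trivial, T, ?_, fun q hq =>
    ⟨hT.ne_zero hS h0 hq.1, rfl⟩⟩, fun p hp V hV hV' => ?_⟩, fun j =>
    ⟨contDiffOn_dualCoord hS h0 j, fun p hp V hV => hspan p hp V hV j⟩⟩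
  · simpa using hT.tangential.1
  · have h1 := hspan p hp V hV
    have h2 := hspan p hp _ hV'
    simp only [derivAlong, CVec.realPart_conjugate, CVec.imagPart_conjugate, map_neg] at h1 h2
    have hVt := htan p hp hV
    refine CVec.eq_zero_of_parts
      (eq_zero_of_fderivWithin_dualCoord hS hconv h0 hp hVt.1 fun j => ?_)
      (eq_zero_of_fderivWithin_dualCoord hS hconv h0 hp hVt.2 fun j => ?_)
    · linear_combination (h1 j + h2 j) / 2
    · have : Complex.I * fderivWithin ℝ (dualCoord S j) S p V.imagPart = 0 := by
        linear_combination (h1 j - h2 j) / 2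
      exact (mul_eq_zero.1 this).resolve_left Complex.I_ne_zero

theorem isDualCRFunction_iff (hS : IsRealHypersurface S) (hconv : IsStronglyCConvex S)
    (h0 : NoComplexTangentLineThroughZero S) (hX : IsFieldX S X) (hT : IsFieldT S T)
    {g : CPlane → ℂ} :
    IsDualCRFunction S g ↔ ContDiffOn ℝ ∞ g S ∧ ∀ p ∈ S, fieldApply S T g p = 0 := by
  constructor
  · rintro ⟨L, ⟨hL, hLw⟩, hg, hgL⟩
    refine ⟨hg, fun p hp => hgL p hp _ ?_⟩
    -- A generator of `L p` annihilates `w_1, w_2`, so it is a multiple of `T p`.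
    obtain ⟨U, -, hpU, V, -, hV⟩ := hL.line_bundle p hp
    obtain ⟨hV0, hVL⟩ := hV p ⟨hp, hpU⟩
    have hVp : V p ∈ L p := hVL ▸ Submodule.mem_span_singleton_self _
    have hVt := hL.tangential p hp hVp
    have hVw : ∀ j, derivAlong S (dualCoord S j) p (V p) = 0 := fun j => (hLw j).2 p hp _ hVp
    have hrel := mul_derivAlong_dualCoord_sum hS h0 hp hVt
    have hfr := eq_frame_combination hS hconv h0 hX hT hp hVt
    simp only [hVw, mul_zero, add_zero, sub_zero, zero_smul, zero_add] at hrel hfr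
    rw [neg_eq_zero.1 hrel.symm, zero_smul, sub_zero] at hfr
    set b := p 1 * (V p).1 0 - p 0 * (V p).1 1
    have hb : b ≠ 0 := fun hb => hV0 (by rw [hfr, hb, zero_smul])
    have : T p = b⁻¹ • V p := by rw [hfr, smul_smul, inv_mul_cancel₀ hb, one_smul]
    rw [this]
    exact Submodule.smul_mem _ _ hVp
  · rintro ⟨hg, hgT⟩
    refine ⟨_, isDualCRStructure_span hS hconv h0 hT, hg, fun p hp V hV => ?_⟩
    obtain ⟨c, rfl⟩ := Submodule.mem_span_singleton.1 hV
    have := hgT p hp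
    rw [fieldApply] at this
    rw [derivAlong_smul_vec, this, mul_zero]

end Fields

/-! ### The decomposition -/

section Decomposition

variable {S : Set CPlane} {X T : CPlane → CVec}

theorem fieldApply_third_order_of_sum (hS : IsRealHypersurface S) (hconv : IsStronglyCConvex S)
    (h0 : NoComplexTangentLineThroughZero S) (hX : IsFieldX S X) (hT : IsFieldT S T)
    {u f g : CPlane → ℂ} (hf : ContDiffOn ℝ ∞ f S) (hXf : ∀ p ∈ S, fieldApply S X f p = 0)
    (hg : ContDiffOn ℝ ∞ g S) (hTg : ∀ p ∈ S, fieldApply S T g p = 0)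
    (hu : ∀ p ∈ S, u p = f p + g p) :
    (∀ p ∈ S, fieldApply S X (fieldApply S X (fieldApply S T u)) p = 0) ∧
      ∀ p ∈ S, fieldApply S T (fieldApply S T (fieldApply S X u)) p = 0 := by
  have hXt := hX.tangential
  have hTt := hT.tangential
  have hY := isTangentialField_fieldBracket hS hXt hTt
  have hadd : ∀ {Z : CPlane → CVec}, IsTangentialField S Z → ∀ p ∈ S,
      fieldApply S Z u p = fieldApply S Z f p + fieldApply S Z g p := fun hZ p hp =>
    (fieldApply_congr _ hu hp).trans (derivAlong_add hS hp hf hg (hZ.2 p hp))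
  have hTu : Set.EqOn (fieldApply S T u) (fieldApply S T f) S := fun p hp => by
    rw [hadd hTt p hp, hTg p hp, add_zero]
  have hXu : Set.EqOn (fieldApply S X u) (fieldApply S X g) S := fun p hp => by
    rw [hadd hXt p hp, hXf p hp, zero_add]
  -- On functions annihilated by `X` the operator `X T` agrees with `Y`.
  have hXT : Set.EqOn (fieldApply S X (fieldApply S T u))
      (fieldApply S (fieldBracket S X T) f) S := fun p hp => by
    rw [fieldApply_congr X hTu hp, fieldApply_fieldBracket hS hXt hTt hf hp,
      fieldApply_zero_fun hS hTt hXf hp, sub_zero]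
  have hTX : Set.EqOn (fieldApply S T (fieldApply S X u))
      (fun p => -fieldApply S (fieldBracket S X T) g p) S := fun p hp => by
    simp only
    rw [fieldApply_congr T hXu hp, fieldApply_fieldBracket hS hXt hTt hg hp,
      fieldApply_zero_fun hS hXt hTg hp, zero_sub, neg_neg]
  refine ⟨fun p hp => ?_, fun p hp => ?_⟩
  · have h := fieldApply_fieldBracket hS hXt hY hf hp
    rw [fieldApply_zero_fun hS hY hXf hp, fieldApply, fieldBracket_X_Y hS hconv h0 hX hT hp,
      derivAlong_smul_vec] at h
    have hz := hXf p hp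
    rw [fieldApply] at hz
    rw [fieldApply_congr X hXT hp]
    linear_combination -h + 2 * hz
  · have h := fieldApply_fieldBracket hS hTt hY hg hp
    rw [fieldApply_zero_fun hS hY hTg hp, fieldApply, fieldBracket_T_Y hS hconv h0 hX hT hp,
      derivAlong_smul_vec] at h
    have hz := hTg p hp
    rw [fieldApply] at hz
    rw [fieldApply_congr T hTX hp, fieldApply,
      derivAlong_neg hS hp (contDiffOn_fieldApply hS hY hg) (hTt.2 p hp)]
    change -fieldApply S T (fieldApply S (fieldBracket S X T) g) p = 0
    linear_combination h + 2 * hz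

/-- A real tangent vector as a complex tangent vector. -/
theorem mk_conj_mem_complexifiedTangentSpace {p v : CPlane} (hv : v ∈ realTangentSpace S p) :
    ((v, fun j => conj (v j)) : CVec) ∈ complexifiedTangentSpace S p ∧
      ∀ u, derivAlong S u p (v, fun j => conj (v j)) = fderivWithin ℝ u S p v := by
  have h1 : CVec.realPart (v, fun j => conj (v j)) = v := by
    ext j; simp [CVec.realPart]
  have h2 : CVec.imagPart (v, fun j => conj (v j)) = 0 := by
    ext j; simp [CVec.imagPart]
  refine ⟨⟨h1.symm ▸ hv, h2.symm ▸ zero_mem _⟩, fun u => ?_⟩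
  rw [derivAlong, h1, h2, map_zero, mul_zero, add_zero]

/-- The CR summand `f` of `u` has to satisfy `X f = 0`, `T f = T u` and `[X, T] f = X T u`. These
equations say that `df = a_1 dz_1 + a_2 dz_2` on `S` for the functions `a_j` used in the proof, and
the two third-order equations for `u` make this form closed. -/
theorem exists_cr_summand (hS : IsRealHypersurface S) (hconv : IsStronglyCConvex S)
    (hsc : SimplyConnectedSpace S) (h0 : NoComplexTangentLineThroughZero S)
    (hX : IsFieldX S X) (hT : IsFieldT S T) {u : CPlane → ℂ} (hu : ContDiffOn ℝ ∞ u S)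
    (hXXT : ∀ p ∈ S, fieldApply S X (fieldApply S X (fieldApply S T u)) p = 0)
    (hTTX : ∀ p ∈ S, fieldApply S T (fieldApply S T (fieldApply S X u)) p = 0) :
    ∃ f : CPlane → ℂ, ContDiffOn ℝ ∞ f S ∧ (∀ p ∈ S, fieldApply S X f p = 0) ∧
      ∀ p ∈ S, fieldApply S T f p = fieldApply S T u p := by
  have hXt := hX.tangential
  have hTt := hT.tangential
  have hY := isTangentialField_fieldBracket hS hXt hTt
  set Y := fieldBracket S X T with hYdef
  have hw := contDiffOn_dualCoord hS h0
  have hz := contDiffOn_coord S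
  set P := fieldApply S T u with hP
  set Q := fieldApply S X P with hQ
  have hPs : ContDiffOn ℝ ∞ P S := contDiffOn_fieldApply hS hTt hu
  have hQs : ContDiffOn ℝ ∞ Q S := contDiffOn_fieldApply hS hXt hPs
  let a0 : CPlane → ℂ := fun q => q 1 * P q - dualCoord S 0 q * Q q
  let a1 : CPlane → ℂ := fun q => -(q 0 * P q + dualCoord S 1 q * Q q)
  have ha0 : ContDiffOn ℝ ∞ a0 S := ((hz 1).mul hPs).sub ((hw 0).mul hQs)
  have ha1 : ContDiffOn ℝ ∞ a1 S := (((hz 0).mul hPs).add ((hw 1).mul hQs)).neg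
  have hd0 : ∀ {p}, p ∈ S → ∀ {V}, V ∈ complexifiedTangentSpace S p → derivAlong S a0 p V
      = p 1 * derivAlong S P p V + P p * V.1 1
        - (dualCoord S 0 p * derivAlong S Q p V + Q p * derivAlong S (dualCoord S 0) p V) := by
    intro p hp V hV
    rw [derivAlong_sub hS hp ((hz 1).mul hPs) ((hw 0).mul hQs) hV,
      derivAlong_mul hS hp (hz 1) hPs hV, derivAlong_mul hS hp (hw 0) hQs hV,
      derivAlong_fst hS hp hV]
  have hd1 : ∀ {p}, p ∈ S → ∀ {V}, V ∈ complexifiedTangentSpace S p → derivAlong S a1 p V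
      = -(p 0 * derivAlong S P p V + P p * V.1 0
        + (dualCoord S 1 p * derivAlong S Q p V + Q p * derivAlong S (dualCoord S 1) p V)) := by
    intro p hp V hV
    rw [derivAlong_neg hS hp (((hz 0).mul hPs).add ((hw 1).mul hQs)) hV,
      derivAlong_add hS hp ((hz 0).mul hPs) ((hw 1).mul hQs) hV,
      derivAlong_mul hS hp (hz 0) hPs hV, derivAlong_mul hS hp (hw 1) hQs hV,
      derivAlong_fst hS hp hV]
  have hclosed : ∀ p ∈ S, ∀ V ∈ complexifiedTangentSpace S p, ∀ W ∈ complexifiedTangentSpace S p,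
      derivAlong S a0 p V * W.1 0 + derivAlong S a1 p V * W.1 1
        = derivAlong S a0 p W * V.1 0 + derivAlong S a1 p W * V.1 1 := by
    intro p hp V hV W hW
    have hone := mul_dualCoord_sum hS h0 hp
    have hX0 := hX.apply_w0 p hp
    have hX1 := hX.apply_w1 p hp
    have hT0 := hT.apply_w 0 p hp
    have hT1 := hT.apply_w 1 p hp
    have hY0 := fieldBracket_dualCoord hS h0 hX hT hp 0
    have hY1 := fieldBracket_dualCoord hS h0 hX hT hp 1
    have hXQ : derivAlong S Q p (X p) = 0 := hXXT p hp
    have hXP : derivAlong S P p (X p) = Q p := rfl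
    -- The relation `Y T u = T X T u + 2 T u`.
    have hYP : derivAlong S P p (Y p) = derivAlong S Q p (T p) + 2 * P p := by
      have h1 := fieldApply_fieldBracket hS hTt hY hu hp
      rw [fieldApply, fieldBracket_T_Y hS hconv h0 hX hT hp, derivAlong_smul_vec] at h1
      have h2 : fieldApply S T (fieldApply S Y u) p = fieldApply S T Q p := by
        rw [fieldApply_congr T (fun q hq => fieldApply_fieldBracket hS hXt hTt hu hq) hp,
          fieldApply, derivAlong_sub hS hp hQs (contDiffOn_fieldApply hS hTt
            (contDiffOn_fieldApply hS hXt hu)) (hTt.2 p hp)]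
        have := hTTX p hp
        rw [fieldApply] at this
        rw [this, sub_zero]
        rfl
      rw [h2] at h1
      change -2 * P p = derivAlong S Q p (T p) - derivAlong S P p (Y p) at h1
      linear_combination h1
    rw [fieldApply] at hX0 hX1 hT0 hT1 hY0 hY1
    have hXa0 : derivAlong S a0 p (X p) = 0 := by
      rw [hd0 hp (hXt.2 p hp), hXQ, hXP, hX0, hX.fst_eq_zero hS hp]; ring
    have hXa1 : derivAlong S a1 p (X p) = 0 := by
      rw [hd1 hp (hXt.2 p hp), hXQ, hXP, hX1, hX.fst_eq_zero hS hp]; ring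
    have hTY : derivAlong S a0 p (T p) * (Y p).1 0 + derivAlong S a1 p (T p) * (Y p).1 1
        = derivAlong S a0 p (Y p) * (T p).1 0 + derivAlong S a1 p (Y p) * (T p).1 1 := by
      rw [hd0 hp (hTt.2 p hp), hd1 hp (hTt.2 p hp), hd0 hp (hY.2 p hp), hd1 hp (hY.2 p hp), hT0,
        hT1, hY0, hY1, hYP, hT.fst_zero hS hp, hT.fst_one hS hp, hYdef,
        fieldBracket_fst hS h0 hX hT hp, fieldBracket_fst hS h0 hX hT hp]
      ring
    have hVf := eq_frame_combination hS hconv h0 hX hT hp hV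
    have hWf := eq_frame_combination hS hconv h0 hX hT hp hW
    generalize dualCoord S 1 p * derivAlong S (dualCoord S 0) p V
        - dualCoord S 0 p * derivAlong S (dualCoord S 1) p V = α at hVf
    generalize p 1 * V.1 0 - p 0 * V.1 1 = β at hVf
    generalize dualCoord S 0 p * V.1 0 + dualCoord S 1 p * V.1 1 = γ at hVf
    generalize dualCoord S 1 p * derivAlong S (dualCoord S 0) p W
        - dualCoord S 0 p * derivAlong S (dualCoord S 1) p W = α' at hWf
    generalize p 1 * W.1 0 - p 0 * W.1 1 = β' at hWf
    generalize dualCoord S 0 p * W.1 0 + dualCoord S 1 p * W.1 1 = γ' at hWf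
    rw [hVf, hWf]
    simp only [derivAlong_sub_vec, derivAlong_add_vec, derivAlong_smul_vec, hXa0, hXa1,
      Prod.fst_sub, Prod.fst_add, Prod.smul_fst, Pi.sub_apply, Pi.add_apply, Pi.smul_apply,
      smul_eq_mul, hX.fst_eq_zero hS hp]
    linear_combination (β' * γ - β * γ') * hTY
  obtain ⟨f, hf, hfD⟩ := hS.exists_primitive hsc (a := ![a0, a1])
    (fun j => by fin_cases j; exacts [ha0, ha1]) (by
      intro p hp v hv w hw
      obtain ⟨hv1, hv2⟩ := mk_conj_mem_complexifiedTangentSpace hv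
      obtain ⟨hw1, hw2⟩ := mk_conj_mem_complexifiedTangentSpace hw
      have := hclosed p hp _ hv1 _ hw1
      rw [hv2, hv2, hw2, hw2] at this
      simpa [Fin.sum_univ_two] using this)
  simp only [Fin.sum_univ_two, Matrix.cons_val_zero, Matrix.cons_val_one] at hfD
  refine ⟨f, hf, fun p hp => ?_, fun p hp => ?_⟩
  · rw [fieldApply, hfD p hp _ (hXt.2 p hp), hX.fst_eq_zero hS hp, hX.fst_eq_zero hS hp]
    ring
  · rw [fieldApply, hfD p hp _ (hTt.2 p hp), hT.fst_zero hS hp, hT.fst_one hS hp]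
    simp only [a0, a1]
    linear_combination P p * mul_dualCoord_sum hS h0 hp

end Decomposition

theorem theoremA (S : Set CPlane) (hS : IsRealHypersurface S) (hconv : IsStronglyCConvex S)
    (hsc : SimplyConnectedSpace S) (h0 : NoComplexTangentLineThroughZero S) :
    ∃ X T : CPlane → CVec,
      (IsFieldX S X ∧ ∀ X', IsFieldX S X' → Set.EqOn X' X S) ∧
      (IsFieldT S T ∧ ∀ T', IsFieldT S T' → Set.EqOn T' T S) ∧
      ∀ u : CPlane → ℂ, ContDiffOn ℝ ∞ u S →
        ((∃ f g : CPlane → ℂ, IsCRFunction S f ∧ IsDualCRFunction S g ∧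
            ∀ p ∈ S, u p = f p + g p) ↔
          ((∀ p ∈ S, fieldApply S X (fieldApply S X (fieldApply S T u)) p = 0) ∧
            ∀ p ∈ S, fieldApply S T (fieldApply S T (fieldApply S X u)) p = 0)) := by
  obtain ⟨X, hX⟩ := exists_isFieldX hS hconv h0
  obtain ⟨T, hT⟩ := exists_isFieldT hS h0 hX
  refine ⟨X, T, ⟨hX, fun X' hX' => hX.eqOn hS hconv h0 hX'⟩,
    ⟨hT, fun T' hT' => hT.eqOn hS hconv h0 hT'⟩, fun u hu => ⟨?_, ?_⟩⟩
  · rintro ⟨f, g, hf, hg, hfg⟩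
    obtain ⟨hf, hXf⟩ := (isCRFunction_iff hS hconv h0 hX hT).1 hf
    obtain ⟨hg, hTg⟩ := (isDualCRFunction_iff hS hconv h0 hX hT).1 hg
    exact fieldApply_third_order_of_sum hS hconv h0 hX hT hf hXf hg hTg hfg
  · rintro ⟨hXXT, hTTX⟩
    obtain ⟨f, hf, hXf, hTf⟩ := exists_cr_summand hS hconv hsc h0 hX hT hu hXXT hTTX
    refine ⟨f, fun p => u p - f p, (isCRFunction_iff hS hconv h0 hX hT).2 ⟨hf, hXf⟩,
      (isDualCRFunction_iff hS hconv h0 hX hT).2 ⟨hu.sub hf, fun p hp => ?_⟩, fun p _ => by ring⟩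
    have := hTf p hp
    rw [fieldApply] at this ⊢
    rw [derivAlong_sub hS hp hu hf (hT.tangential.2 p hp), this]
    exact sub_self _
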